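/- **Theorem (TORNADO's correctness).** Let $\mathcal K$ be a finite probabilistic knowledge base in the description logic $\mathcal{SHI}$ (atomic concepts, $\top,\bot,\neg,\sqcap,\sqcup,\exists R.C,\forall R.C$, atomic roles and their inverses; axioms $C\sqsubseteq D$, $R\sqsubseteq S$, $Trans(R)$, $a:C$, $(a,b):r$ with $r$ atomic), i.e. a finite family of axioms $E_i$, each of which is either certain or carries a probability $p_i\in[0,1]$; put $p_i=1$ for certain axioms. Let $Q$ be an axiom (the query). For a set $\sigma$ of probabilistic axioms let $w_\sigma$ be the set of all certain axioms together with those in $\sigma$, $P(w_\sigma)=\prod_{i\in\sigma}p_i\prod_{i\notin\sigma}(1-p_i)$ (over the probabilistic axioms $i$), and $$P(Q)=\sum_{\sigma:\,w_\sigma\models Q}P(w_\sigma),$$ where $\models$ is entailment over all interpretations with non-empty domain. TORNADO works as follows. A *tableau* is a finite set of assertions $x:C$ ($C$ in negation normal form) and $(x,y):r$, each labelled with a reduced ordered binary decision diagram (BDD) over Boolean variables $X_i$, one for each axiom $E_i$, in a fixed variable order; $(x,y):r^-$ stands for $(y,x):r$. The initial tableau contains assertions expressing $\neg Q$ labelled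 $\top$, and the membership axioms of $\mathcal K$ labelled with their variables. Here $\neg Q$ is: $a:\neg C$ for $Q=(a:C)$; $x_0:C\sqcap\neg D$ for $Q=(C\sqsubseteq D)$; $b:N,\ a:\forall r.\neg N$ for $Q=((a,b):r)$; $(x_0,x_1):R,\ x_1:N,\ x_0:\forall S.\neg N$ for $Q=(R\sqsubseteq S)$; $(x_0,x_1):R,\ (x_1,x_2):R,\ x_2:N,\ x_0:\forall R.\neg N$ for $Q=Trans(R)$, with fresh individuals $x_i$ and a fresh atomic concept $N$. An assertion $a$ is *$\psi$-insertable* if it is absent or $lab(a)\vee\psi\neq lab(a)$ as BDDs; $\psi$-insertion of a set adds its absent members with label $\psi$ and replaces the label of its other $\psi$-insertable members by $lab(a)\vee\psi$. Write $R\sqsubseteq^*_E S$ if $R$ is a sub-role of $S$ by the role inclusions in $E\subseteq\mathcal K$ (reflexively, transitively, and closed under inverses). The rules are as follows, with $\psi$ always the conjunction of the labels of the assertions and of the variables of the axioms used: - *unfold*: from $x:A$ with $A$ atomic and $A\sqsubseteq D\in\mathcal K$, add $x:D$; - *CE*: from $C\sqsubseteq D\in\mathcal K$ with $C$ not atomic,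 add $x:\neg C\sqcup D$ for all individuals $x$ of the tableau; - $\sqcap$: from $x:C_1\sqcap C_2$, add $x:C_1$ and $x:C_2$; - $\sqcup$: from $x:C_1\sqcup C_2$, replace the tableau by two, adding $x:C_1$ in one and $x:C_2$ in the other; - $\forall$: from $x:\forall S.C$, $(x,y):R_0$ and $R_0\sqsubseteq^*_E S$, add $y:C$; - $\forall^+$: from $x:\forall S.C$, $(x,y):R_0$, $R_0\sqsubseteq^*_E R\sqsubseteq^*_E S$, and $Trans(R)$ or $Trans(R^-)$ in $\mathcal K$, add $y:\forall R.C$; - $\exists$: from $x:\exists S.C$ with $x$ not blocked, add $(x,y):S$ and $y:C$ for a new child $y$ of $x$, provided that there is no $z$ such that $z:C$ is present and not $\psi$-insertable and $\psi$ implies $lab((x,z):R)\wedge\bigwedge_{i\in E}X_i$ for some present $(x,z):R$ and some $E$ with $R\sqsubseteq^*_E S$. The non-generating rules are applicable only if each of the sets to be added contains a $\psi$-insertable assertion. A generated individual is *blocked* if one of its predecessors (ancestors) has the same concept annotations with equal labels, or if its parent is blocked. A forest, initially the initial tableau alone, is expanded by replacing a tableau by the result(s) of an applicable rule, in any order, and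 is fully expanded if no rule applies to any of its tableaux. The final BDD of a forest is the conjunction, over its tableaux, of the disjunction of the clash labels: $lab(x:A)\wedge lab(x:\neg A)$ for each clash $x:A,\ x:\neg A$, and $lab(x:\bot)$ for each $x:\bot$. TORNADO returns $\mathrm{Prob}$ of the final BDD of a fully expanded forest, where $\mathrm{Prob}$ of a leaf is its value and $\mathrm{Prob}(n)=p_i\,\mathrm{Prob}(\mathrm{child}_1(n))+(1-p_i)\,\mathrm{Prob}(\mathrm{child}_0(n))$ for a node $n$ with variable $X_i$. Then, for all such $\mathcal K$ and $Q$, every run of TORNADO terminates, and the value returned is $P(Q)$: a real number $r$ is returned by some run if and only if $r=P(Q)$. -/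

import Mathlib

universe v

namespace Tornado

/-! ## The description logic SHI: syntax

`NC`, `NR`, `NI` are the sets of atomic concepts, atomic roles and individuals. -/

/-- Roles: atomic roles and inverses of atomic roles. -/
inductive Role (NR : Type*) where
  | atom (r : NR)
  | inv (r : NR)

/-- The inverse of a role, with `(r⁻)⁻ = r`. -/
def Role.inverse {NR : Type*} : Role NR → Role NR
  | .atom r => .inv r
  | .inv r => .atom r

/-- Concepts of SHI. -/
inductive Concept (NC NR : Type*) where
  | top
  | bot
  | atom (A : NC)
  | neg (C : Concept NC NR)
  | inter (C D : Concept NC NR)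
  | union (C D : Concept NC NR)
  | ex (R : Role NR) (C : Concept NC NR)
  | all (R : Role NR) (C : Concept NC NR)

/-- A concept is atomic if it is an element of `NC`; all other concepts (`⊤` and `⊥` included)
are complex. -/
def Concept.IsAtomic {NC NR : Type*} : Concept NC NR → Prop
  | .atom _ => True
  | _ => False

/-- Axioms of a SHI knowledge base: `Trans(R)`, `R ⊑ S`, `C ⊑ D`, `a : C` and `(a, b) : r`. -/
inductive KBAxiom (NC NR NI : Type*) where
  | trans (R : Role NR)
  | roleIncl (R S : Role NR)
  | conceptIncl (C D : Concept NC NR)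
  | conceptMem (a : NI) (C : Concept NC NR)
  | roleMem (a b : NI) (r : NR)

/-! ## Semantics of SHI -/

/-- An interpretation with domain `Δ`. -/
structure Interp (NC NR NI : Type*) (Δ : Type v) where
  con : NC → Set Δ
  rol : NR → Δ → Δ → Prop
  ind : NI → Δ

namespace Interp

variable {NC NR NI : Type*} {Δ : Type v}

def role (I : Interp NC NR NI Δ) : Role NR → Δ → Δ → Prop
  | .atom r => fun x y => I.rol r x y
  | .inv r => fun x y => I.rol r y x

def concept (I : Interp NC NR NI Δ) : Concept NC NR → Set Δ
  | .top => Set.univ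
  | .bot => ∅
  | .atom A => I.con A
  | .neg C => (I.concept C)ᶜ
  | .inter C D => I.concept C ∩ I.concept D
  | .union C D => I.concept C ∪ I.concept D
  | .ex R C => {x | ∃ y, I.role R x y ∧ y ∈ I.concept C}
  | .all R C => {x | ∀ y, I.role R x y → y ∈ I.concept C}

def Satisfies (I : Interp NC NR NI Δ) : KBAxiom NC NR NI → Prop
  | .trans R => ∀ x y z, I.role R x y → I.role R y z → I.role R x z
  | .roleIncl R S => ∀ x y, I.role R x y → I.role S x y
  | .conceptIncl C D => I.concept C ⊆ I.concept D
  | .conceptMem a C => I.ind a ∈ I.concept C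
  | .roleMem a b r => I.rol r (I.ind a) (I.ind b)

end Interp

/-- `W ⊨ Q`: every interpretation (with non-empty domain) that satisfies all axioms of `W`
satisfies `Q`. -/
def Entails {NC NR NI : Type*} (W : Set (KBAxiom NC NR NI)) (Q : KBAxiom NC NR NI) : Prop :=
  ∀ (Δ : Type v) [Nonempty Δ] (I : Interp NC NR NI Δ), (∀ E ∈ W, I.Satisfies E) → I.Satisfies Q

/-! ## Probabilistic knowledge bases and the DISPONTE semantics -/

/-- A probabilistic knowledge base, as a family of axioms indexed by `ι` (finite in all uses).
`ann i = none` means that the `i`-th axiom is certain, `ann i = some p` that it is the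
probabilistic axiom `p :: ax i`. -/
structure ProbKB (NC NR NI ι : Type*) where
  ax : ι → KBAxiom NC NR NI
  ann : ι → Option unitInterval

namespace ProbKB

variable {NC NR NI ι : Type*}

/-- The probability that the `i`-th axiom belongs to a world; it is `1` for a certain axiom. -/
noncomputable def p (K : ProbKB NC NR NI ι) (i : ι) : ℝ :=
  match K.ann i with
  | some q => (q : ℝ)
  | none => 1

/-- The set of (indices of) probabilistic axioms. -/
def probabilistic [Fintype ι] (K : ProbKB NC NR NI ι) : Finset ι :=
  Finset.univ.filter fun i => (K.ann i).isSome

/-- The world of the selection that includes exactly the probabilistic axioms in `σ`. -/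
def world (K : ProbKB NC NR NI ι) (σ : Finset ι) : Set (KBAxiom NC NR NI) :=
  {E | ∃ i, (K.ann i = none ∨ i ∈ σ) ∧ K.ax i = E}

/-- The probability of the world of the selection `σ ⊆ K.probabilistic`. -/
noncomputable def worldProb [Fintype ι] [DecidableEq ι] (K : ProbKB NC NR NI ι)
    (σ : Finset ι) : ℝ :=
  (∏ i ∈ σ, K.p i) * ∏ i ∈ K.probabilistic \ σ, (1 - K.p i)

open Classical in
/-- `P(Q)`: the sum of the probabilities of the worlds that entail `Q`. -/
noncomputable def queryProb [Fintype ι] [DecidableEq ι] (K : ProbKB NC NR NI ι)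
    (Q : KBAxiom NC NR NI) : ℝ :=
  ∑ σ ∈ K.probabilistic.powerset.filter (fun σ => Entails.{v} (K.world σ) Q), K.worldProb σ

end ProbKB

/-! ## Binary decision diagrams

Reduced ordered BDDs over a linearly ordered set `V` of Boolean variables. A diagram is written
as its unfolding, so that isomorphic subdiagrams are equal terms. -/

inductive BDD (V : Type*) where
  | leaf (b : Bool)
  | node (x : V) (child1 child0 : BDD V)

namespace BDD

variable {V : Type*}

open Classical in
/-- Node construction with removal of redundant tests. -/
noncomputable def mk (x : V) (h l : BDD V) : BDD V :=
  if h = l then h else node x h l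

/-- The usual `apply` procedure, which combines two diagrams by a Boolean operation. -/
noncomputable def apply [LinearOrder V] (op : Bool → Bool → Bool) : BDD V → BDD V → BDD V
  | leaf a, leaf b => leaf (op a b)
  | leaf a, node y h l => mk y (apply op (leaf a) h) (apply op (leaf a) l)
  | node x h l, leaf b => mk x (apply op h (leaf b)) (apply op l (leaf b))
  | node x h l, node y h' l' =>
    if x = y then mk x (apply op h h') (apply op l l')
    else if x < y then mk x (apply op h (node y h' l')) (apply op l (node y h' l'))
    else mk y (apply op (node x h l) h') (apply op (node x h l) l')
  termination_by A B => sizeOf A + sizeOf B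

/-- The diagram of a single variable. -/
def var (x : V) : BDD V := node x (leaf true) (leaf false)

noncomputable def and [LinearOrder V] (A B : BDD V) : BDD V := apply Bool.and A B

noncomputable def or [LinearOrder V] (A B : BDD V) : BDD V := apply Bool.or A B

noncomputable def conj [LinearOrder V] (L : List (BDD V)) : BDD V := L.foldr and (leaf true)

noncomputable def disj [LinearOrder V] (L : List (BDD V)) : BDD V := L.foldr or (leaf false)

/-- The function `Prob`: `p x` is the probability of the variable `x`. -/
noncomputable def prob (p : V → ℝ) : BDD V → ℝ
  | leaf b => if b then 1 else 0
  | node x h l => p x * prob p h + (1 - p x) * prob p l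

end BDD

/-! ## Tableaux -/

/-- Concepts in negation normal form, over the atomic concepts `some A` with `A : NC` and one
extra atomic concept `none`, which occurs in no axiom and is used to negate role queries. -/
inductive NConcept (NC NR : Type*) where
  | top
  | bot
  | atom (A : Option NC)
  | natom (A : Option NC)
  | inter (C D : NConcept NC NR)
  | union (C D : NConcept NC NR)
  | ex (R : Role NR) (C : NConcept NC NR)
  | all (R : Role NR) (C : NConcept NC NR)

/-- `nnf true C` is the negation normal form of `C`, `nnf false C` that of `¬C`. -/
def Concept.nnf {NC NR : Type*} : Bool → Concept NC NR → NConcept NC NR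
  | true, .top => .top
  | false, .top => .bot
  | true, .bot => .bot
  | false, .bot => .top
  | true, .atom A => .atom (some A)
  | false, .atom A => .natom (some A)
  | true, .neg C => C.nnf false
  | false, .neg C => C.nnf true
  | true, .inter C D => .inter (C.nnf true) (D.nnf true)
  | false, .inter C D => .union (C.nnf false) (D.nnf false)
  | true, .union C D => .union (C.nnf true) (D.nnf true)
  | false, .union C D => .inter (C.nnf false) (D.nnf false)
  | true, .ex R C => .ex R (C.nnf true)
  | false, .ex R C => .all R (C.nnf false)
  | true, .all R C => .all R (C.nnf true)
  | false, .all R C => .ex R (C.nnf false)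

/-- Nodes of a tableau: the individuals of the language, individuals introduced to negate the
query, and the anonymous individuals generated by rules; `anon x k` is generated for `x`, which
is its parent. -/
inductive Node (NI : Type*) where
  | named (a : NI)
  | query (k : ℕ)
  | anon (x : Node NI) (k : ℕ)

/-- `Ancestor x y`: `x` is a (not necessarily immediate) predecessor of `y`. -/
def Ancestor {NI : Type*} (x : Node NI) : Node NI → Prop
  | .named _ => False
  | .query _ => False
  | .anon y _ => x = y ∨ Ancestor x y

/-- Assertions `x : C` and `(x, y) : r`. -/
inductive Assertion (NC NR NI : Type*) where
  | concept (x : Node NI) (C : NConcept NC NR)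
  | edge (x y : Node NI) (r : NR)

namespace Assertion

variable {NC NR NI : Type*}

/-- The assertion `(x, y) : R`; for an inverse role `r⁻` it is `(y, x) : r`. -/
def role (x y : Node NI) : Role NR → Assertion NC NR NI
  | .atom r => .edge x y r
  | .inv r => .edge y x r

open Classical in
/-- The individuals that occur in an assertion. -/
noncomputable def nodes : Assertion NC NR NI → Finset (Node NI)
  | .concept x _ => {x}
  | .edge x y _ => {x, y}

end Assertion

/-- A tableau: a finite set of assertions, labelled with BDDs over the variables `ι`. The values
of `lab` outside the set are irrelevant. -/
structure Tableau (NC NR NI ι : Type*) where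
  assertions : Finset (Assertion NC NR NI)
  lab : Assertion NC NR NI → BDD ι

namespace Tableau

variable {NC NR NI ι : Type*}

open Classical in
/-- The individuals that occur in a tableau. -/
noncomputable def nodes (T : Tableau NC NR NI ι) : Finset (Node NI) :=
  T.assertions.biUnion Assertion.nodes

/-- `a` is `ψ`-insertable: `a` is not in `T`, or the disjunction of its label with `ψ` is a BDD
other than its label. -/
def Insertable [LinearOrder ι] (T : Tableau NC NR NI ι) (ψ : BDD ι)
    (a : Assertion NC NR NI) : Prop :=
  a ∉ T.assertions ∨ BDD.or (T.lab a) ψ ≠ T.lab a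

open Classical in
/-- The set of `ψ`-insertable elements of `B`. -/
noncomputable def ins [LinearOrder ι] (T : Tableau NC NR NI ι) (ψ : BDD ι)
    (B : Finset (Assertion NC NR NI)) : Finset (Assertion NC NR NI) :=
  B.filter (T.Insertable ψ)

open Classical in
/-- The `ψ`-insertion of `B` into `T`. -/
noncomputable def insertion [LinearOrder ι] (T : Tableau NC NR NI ι) (ψ : BDD ι)
    (B : Finset (Assertion NC NR NI)) : Tableau NC NR NI ι where
  assertions := T.assertions ∪ T.ins ψ B
  lab a :=
    if a ∈ T.ins ψ B then
      if a ∈ T.assertions then BDD.or (T.lab a) ψ else ψ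
    else T.lab a

/-- The individuals `x` and `y` have the same annotations, with equal labels. -/
def SameAnnotations (T : Tableau NC NR NI ι) (x y : Node NI) : Prop :=
  ∀ C, (Assertion.concept x C ∈ T.assertions ↔ Assertion.concept y C ∈ T.assertions) ∧
    (Assertion.concept x C ∈ T.assertions →
      T.lab (Assertion.concept x C) = T.lab (Assertion.concept y C))

/-- Blocking: a generated individual is blocked if it has the same annotations, with equal
labels, as one of its predecessors, or if its parent is blocked. -/
def Blocked (T : Tableau NC NR NI ι) : Node NI → Prop
  | .named _ => False
  | .query _ => False
  | .anon x k =>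
    (∃ y, Ancestor y (.anon x k) ∧ T.SameAnnotations y (.anon x k)) ∨ T.Blocked x

open Classical in
/-- The label contributed by the assertion `a` as the negative part of a clash: `x : ⊥` is a clash,
and so are `x : ¬A` and `x : A` together. -/
noncomputable def clashLabel [LinearOrder ι] (T : Tableau NC NR NI ι) :
    Assertion NC NR NI → BDD ι
  | .concept x .bot => T.lab (.concept x .bot)
  | .concept x (.natom A) =>
    if Assertion.concept x (.atom A) ∈ T.assertions then
      BDD.and (T.lab (.concept x (.natom A))) (T.lab (.concept x (.atom A)))
    else .leaf false
  | _ => .leaf false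

/-- The disjunction of the labels of all clashes of a tableau. -/
noncomputable def clashBDD [LinearOrder ι] (T : Tableau NC NR NI ι) : BDD ι :=
  BDD.disj (T.assertions.toList.map T.clashLabel)

end Tableau

namespace ProbKB

variable {NC NR NI ι : Type*}

/-- `R` is a sub-role of `S` by means of the role inclusion axioms with index in `E`: the reflexive
transitive closure of these inclusions, where `R ⊑ S` also yields `R⁻ ⊑ S⁻`. -/
def SubRole (K : ProbKB NC NR NI ι) (E : Finset ι) : Role NR → Role NR → Prop :=
  Relation.ReflTransGen fun R S =>
    ∃ i ∈ E, K.ax i = .roleIncl R S ∨ K.ax i = .roleIncl R.inverse S.inverse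

/-- The formula attached to a rule application: the conjunction of the labels of the assertions
`B₀` and of the variables of the axioms `E`. -/
noncomputable def psi [LinearOrder ι] (T : Tableau NC NR NI ι) (B₀ : Finset (Assertion NC NR NI))
    (E : Finset ι) : BDD ι :=
  BDD.and (BDD.conj (B₀.toList.map T.lab)) (BDD.conj (E.toList.map BDD.var))

open Classical in
/-- The instances `(B₀, E) → {B₁, …, Bₗ}` of the rules that generate no individual. In `univ` and
`univPlus`, the assertion `(x, y) : R₀` makes `y` an `S`-successor (an `R`-successor) of `x`. -/
inductive RuleInst (K : ProbKB NC NR NI ι) (T : Tableau NC NR NI ι) :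
    Finset (Assertion NC NR NI) → Finset ι → List (Finset (Assertion NC NR NI)) → Prop
  | unfold (x : Node NI) (A : NC) (D : Concept NC NR) (i : ι)
      (hi : K.ax i = .conceptIncl (.atom A) D) :
      RuleInst K T {.concept x (.atom (some A))} {i} [{.concept x (D.nnf true)}]
  | ce (C D : Concept NC NR) (i : ι) (hC : ¬ C.IsAtomic) (hi : K.ax i = .conceptIncl C D) :
      RuleInst K T ∅ {i}
        [T.nodes.image fun x => .concept x (.union (C.nnf false) (D.nnf true))]
  | inter (x : Node NI) (C D : NConcept NC NR) :
      RuleInst K T {.concept x (.inter C D)} ∅ [{.concept x C, .concept x D}]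
  | union (x : Node NI) (C D : NConcept NC NR) :
      RuleInst K T {.concept x (.union C D)} ∅ [{.concept x C}, {.concept x D}]
  | univ (x y : Node NI) (R₀ S : Role NR) (C : NConcept NC NR) (E : Finset ι)
      (hS : K.SubRole E R₀ S) :
      RuleInst K T {.concept x (.all S C), .role x y R₀} E [{.concept y C}]
  | univPlus (x y : Node NI) (R₀ R S : Role NR) (C : NConcept NC NR) (E : Finset ι) (i : ι)
      (hR : K.SubRole E R₀ R) (hS : K.SubRole E R S)
      (hi : K.ax i = .trans R ∨ K.ax i = .trans R.inverse) :
      RuleInst K T {.concept x (.all S C), .role x y R₀} (insert i E) [{.concept y (.all R C)}]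

/-- In `T`, `z` is an `S`-successor of `x` and an instance of `C`, and this is already recorded
with labels implied by `ψ`; there is then no reason to apply the `∃`-rule to `x : ∃S.C`. -/
def Witness [LinearOrder ι] (K : ProbKB NC NR NI ι) (T : Tableau NC NR NI ι) (ψ : BDD ι)
    (x z : Node NI) (S : Role NR) (C : NConcept NC NR) : Prop :=
  (∃ (R : Role NR) (E : Finset ι), K.SubRole E R S ∧
    (.role x z R) ∈ T.assertions ∧
    BDD.or (psi T {.role x z R} E) ψ = psi T {.role x z R} E) ∧
  ¬ T.Insertable ψ (.concept z C)

open Classical in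
/-- `K.Expands T Ts`: some rule is applicable to the tableau `T`, and its application produces the
tableaux `Ts`. -/
inductive Expands [LinearOrder ι] (K : ProbKB NC NR NI ι) (T : Tableau NC NR NI ι) :
    List (Tableau NC NR NI ι) → Prop
  | rule (B₀ : Finset (Assertion NC NR NI)) (E : Finset ι)
      (Bs : List (Finset (Assertion NC NR NI)))
      (hrule : K.RuleInst T B₀ E Bs) (hB₀ : B₀ ⊆ T.assertions)
      (happ : ∀ B ∈ Bs, (T.ins (psi T B₀ E) B).Nonempty) :
      Expands K T (Bs.map (T.insertion (psi T B₀ E)))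
  | ex (x : Node NI) (S : Role NR) (C : NConcept NC NR) (k : ℕ)
      (hx : Assertion.concept x (.ex S C) ∈ T.assertions)
      (hblock : ¬ T.Blocked x)
      (happ : ∀ z, ¬ K.Witness T (T.lab (.concept x (.ex S C))) x z S C)
      (hfresh : Node.anon x k ∉ T.nodes) :
      Expands K T [T.insertion (T.lab (.concept x (.ex S C)))
        {.role x (.anon x k) S, .concept (.anon x k) C}]

/-- One rule application in a forest of tableaux. -/
inductive Step [LinearOrder ι] (K : ProbKB NC NR NI ι) :
    List (Tableau NC NR NI ι) → List (Tableau NC NR NI ι) → Prop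
  | mk (F₁ F₂ Ts : List (Tableau NC NR NI ι)) (T : Tableau NC NR NI ι) (h : K.Expands T Ts) :
      Step K (F₁ ++ T :: F₂) (F₁ ++ Ts ++ F₂)

/-- No rule is applicable to any tableau of the forest. -/
def FullyExpanded [LinearOrder ι] (K : ProbKB NC NR NI ι) (F : List (Tableau NC NR NI ι)) :
    Prop :=
  ∀ T ∈ F, ∀ Ts, ¬ K.Expands T Ts

end ProbKB

open Classical in
/-- The assertions that express the negation of a query. That `x` and `y` are not related by `R`
is expressed by `y : N` and `x : ∀R.¬N`, where `N` is the extra atomic concept. -/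
noncomputable def negQuery {NC NR NI : Type*} : KBAxiom NC NR NI → Finset (Assertion NC NR NI)
  | .conceptMem a C => {.concept (.named a) (C.nnf false)}
  | .conceptIncl C D => {.concept (.query 0) (.inter (C.nnf true) (D.nnf false))}
  | .roleMem a b r =>
    {.concept (.named b) (.atom none), .concept (.named a) (.all (.atom r) (.natom none))}
  | .roleIncl R S =>
    {.role (.query 0) (.query 1) R,
     .concept (.query 1) (.atom none), .concept (.query 0) (.all S (.natom none))}
  | .trans R =>
    {.role (.query 0) (.query 1) R, .role (.query 1) (.query 2) R,
     .concept (.query 2) (.atom none), .concept (.query 0) (.all R (.natom none))}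

/-- The assertion of a concept or role membership axiom; other axioms give no assertion. -/
def KBAxiom.assertion {NC NR NI : Type*} : KBAxiom NC NR NI → Finset (Assertion NC NR NI)
  | .conceptMem a C => {.concept (.named a) (C.nnf true)}
  | .roleMem a b r => {.edge (.named a) (.named b) r}
  | _ => ∅

namespace ProbKB

variable {NC NR NI ι : Type*}

/-- The initial tableau: the negation of the query labelled with `⊤`, and the assertions of the
knowledge base labelled with their variables. -/
noncomputable def initial [Fintype ι] [LinearOrder ι] (K : ProbKB NC NR NI ι)
    (Q : KBAxiom NC NR NI) : Tableau NC NR NI ι :=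
  (Finset.univ : Finset ι).toList.foldl
    (fun T i => T.insertion (BDD.var i) (K.ax i).assertion)
    ⟨negQuery Q, fun _ => .leaf true⟩

/-- The final BDD of a forest: the conjunction, over its tableaux, of the disjunctions of the
labels of the clashes. -/
noncomputable def finalBDD [LinearOrder ι] (F : List (Tableau NC NR NI ι)) : BDD ι :=
  BDD.conj (F.map Tableau.clashBDD)

/-- `K.TornadoReturns Q r`: some run of TORNADO on `K` and `Q` ends in a fully expanded forest and
returns the probability `r` of its final BDD. -/
def TornadoReturns [Fintype ι] [LinearOrder ι] (K : ProbKB NC NR NI ι) (Q : KBAxiom NC NR NI)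
    (r : ℝ) : Prop :=
  ∃ F, Relation.ReflTransGen K.Step [K.initial Q] F ∧ K.FullyExpanded F ∧
    r = (finalBDD F).prob K.p

/-- Every run of TORNADO on `K` and `Q` is finite. -/
def TornadoTerminates [Fintype ι] [LinearOrder ι] (K : ProbKB NC NR NI ι)
    (Q : KBAxiom NC NR NI) : Prop :=
  ¬ ∃ F : ℕ → List (Tableau NC NR NI ι), F 0 = [K.initial Q] ∧ ∀ n, K.Step (F n) (F (n + 1))

end ProbKB

end Tornado

/-!
A valuation `σ` of the variables `X_i` turns a labelled tableau into an ordinary one, whose assertions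
are those with a label that is true under `σ` (`Tableau.Holds`); inserting a set with label `ψ` adds the
whole set if `ψ` is true under `σ`, and nothing otherwise. For each `σ` separately, TORNADO is thus the
ordinary tableau algorithm for SHI on the axioms selected by `σ`, and the final BDD is true under `σ` if
and only if every tableau of the forest has a clash under `σ`. The proof shows that this happens exactly
if the selected axioms entail the query.

*Soundness* (`ProbKB.entails_of_eval_finalBDD`). A model of the selected axioms in which the query fails
realizes the initial tableau under `σ`, each rule leaves at least one realized tableau
(`ProbKB.Realizes.expands`), and a realized tableau has no clash.

*Completeness* (`ProbKB.eval_finalBDD_of_entails`). A fully expanded tableau without clash under `σ` has a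
canonical model. Its elements are the unblocked individuals, edges are taken up to equality of
annotations, so that edges to a blocked individual lead to the individual that blocks it, and roles are
closed under the selected role inclusions and transitivity axioms. As blocking demands equal
annotations with equal labels, value restrictions pass through the redirected edges in both
directions, and the `∀⁺`-rule carries them along the transitive closure
(`ProbKB.CanonRel.holds_of_all`, `ProbKB.Represents.mem_nconcept`). The model is finite, so it exists in
every universe.

*Termination* (`ProbKB.tornadoTerminates`). All concepts of a run lie in a finite set
(`exists_finite_ruleClosed`), and labels are reduced ordered BDDs, which are determined by their Boolean
functions (`BDD.IsReduced.eq_of_eval_eq`). An unblocked individual and its predecessors therefore have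
pairwise different annotations from a finite set, which bounds the depth, and the `∃`-rule is applied to
an individual at most once for each concept and label, which bounds the number of children. So the
number of pairs of a concept assertion and a valuation for which it holds is bounded, while each rule
application enlarges it; for forests, powers of three make up for the duplication of tableaux.

*Probability* (`ProbKB.prob_finalBDD`). `Prob` of a reduced ordered BDD is the expectation of its Boolean
function for independent variables (`BDD.IsReduced.prob_eq_expect`), and `P(Q)` is the expectation of
entailment, where certain axioms may be treated as probabilistic axioms of probability one
(`ProbKB.queryProb_eq_expect`).
-/

namespace Tornado

/-! ### Binary decision diagrams as Boolean functions -/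

namespace BDD

variable {V : Type*}

/-- The Boolean function of a diagram; a valuation is given by the set of its true variables. -/
def eval [DecidableEq V] : BDD V → Finset V → Bool
  | leaf b, _ => b
  | node x h l, σ => if x ∈ σ then eval h σ else eval l σ

/-- The variables that occur in a diagram. -/
def vars : BDD V → Set V
  | leaf _ => ∅
  | node x h l => insert x (vars h ∪ vars l)

/-- Reduced ordered diagrams. -/
def IsReduced [LinearOrder V] : BDD V → Prop
  | leaf _ => True
  | node x h l => h ≠ l ∧ (∀ y ∈ vars h ∪ vars l, x < y) ∧ IsReduced h ∧ IsReduced l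

theorem eval_congr [DecidableEq V] {σ τ : Finset V} (B : BDD V)
    (h : ∀ y ∈ vars B, (y ∈ σ ↔ y ∈ τ)) : eval B σ = eval B τ := by
  induction B with
  | leaf b => rfl
  | node x h l ih₁ ih₂ =>
    simp only [vars, Set.mem_insert_iff, Set.mem_union] at h
    simp only [eval, h x (.inl rfl), ih₁ fun y hy => h y (.inr (.inl hy)),
      ih₂ fun y hy => h y (.inr (.inr hy))]

theorem eval_mk [DecidableEq V] (x : V) (h l : BDD V) (σ : Finset V) :
    eval (mk x h l) σ = if x ∈ σ then eval h σ else eval l σ := by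
  unfold mk
  split_ifs with h1 h2 <;> simp_all [eval]

theorem vars_mk_subset (x : V) (h l : BDD V) : vars (mk x h l) ⊆ insert x (vars h ∪ vars l) := by
  unfold mk
  split_ifs
  · exact fun y hy => .inr (.inl hy)
  · rfl

theorem IsReduced.mk [LinearOrder V] {x : V} {h l : BDD V} (hh : IsReduced h) (hl : IsReduced l)
    (hx : ∀ y ∈ vars h ∪ vars l, x < y) : IsReduced (mk x h l) := by
  unfold BDD.mk
  split_ifs with h1
  · exact hh
  · exact ⟨h1, hx, hh, hl⟩

theorem isReduced_var [LinearOrder V] (x : V) : IsReduced (var x) := by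
  simp [var, IsReduced, vars]

variable [LinearOrder V]

theorem eval_apply (op : Bool → Bool → Bool) (A B : BDD V) (σ : Finset V) :
    eval (apply op A B) σ = op (eval A σ) (eval B σ) := by
  induction A, B using apply.induct with
  | case1 a b => simp [apply, eval]
  | case2 a y h l ih₁ ih₂ => simp only [apply, eval_mk, ih₁, ih₂, eval]; split_ifs <;> rfl
  | case3 x h l b ih₁ ih₂ => simp only [apply, eval_mk, ih₁, ih₂, eval]; split_ifs <;> rfl
  | case4 h l y h' l' ih₁ ih₂ =>
    rw [apply, if_pos rfl]; simp only [eval_mk, ih₁, ih₂, eval]; split_ifs <;> rfl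
  | case5 x h l y h' l' h1 h2 ih₁ ih₂ =>
    rw [apply, if_neg h1, if_pos h2, eval_mk, ih₁, ih₂]
    conv_rhs => rw [eval]
    split_ifs <;> rfl
  | case6 x h l y h' l' h1 h2 ih₁ ih₂ =>
    rw [apply, if_neg h1, if_neg h2, eval_mk, ih₁, ih₂]
    conv_rhs => enter [2]; rw [eval]
    split_ifs <;> rfl

theorem vars_apply_subset (op : Bool → Bool → Bool) (A B : BDD V) :
    vars (apply op A B) ⊆ vars A ∪ vars B := by
  induction A, B using apply.induct with
  | case1 a b => simp [apply, vars]
  | case2 a y h l ih₁ ih₂ =>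
    rw [apply]; refine (vars_mk_subset _ _ _).trans ?_
    simp only [vars] at *; grind
  | case3 x h l b ih₁ ih₂ =>
    rw [apply]; refine (vars_mk_subset _ _ _).trans ?_
    simp only [vars] at *; grind
  | case4 h l y h' l' ih₁ ih₂ =>
    rw [apply, if_pos rfl]; refine (vars_mk_subset _ _ _).trans ?_
    simp only [vars] at *; grind
  | case5 x h l y h' l' h1 h2 ih₁ ih₂ =>
    rw [apply, if_neg h1, if_pos h2]; refine (vars_mk_subset _ _ _).trans ?_
    simp only [vars] at *; grind
  | case6 x h l y h' l' h1 h2 ih₁ ih₂ =>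
    rw [apply, if_neg h1, if_neg h2]; refine (vars_mk_subset _ _ _).trans ?_
    simp only [vars] at *; grind

theorem IsReduced.apply (op : Bool → Bool → Bool) {A B : BDD V} (hA : IsReduced A)
    (hB : IsReduced B) : IsReduced (apply op A B) := by
  induction A, B using apply.induct with
  | case1 a b => simp [BDD.apply, IsReduced]
  | case2 a y h l ih₁ ih₂ =>
    obtain ⟨-, hv, h1, h2⟩ := hB
    rw [BDD.apply]
    refine .mk (ih₁ hA h1) (ih₂ hA h2) fun z hz => hv z ?_
    have := vars_apply_subset op (leaf a) h
    have := vars_apply_subset op (leaf a) l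
    simp only [vars] at *; grind
  | case3 x h l b ih₁ ih₂ =>
    obtain ⟨-, hv, h1, h2⟩ := hA
    rw [BDD.apply]
    refine .mk (ih₁ h1 hB) (ih₂ h2 hB) fun z hz => hv z ?_
    have := vars_apply_subset op h (leaf b)
    have := vars_apply_subset op l (leaf b)
    simp only [vars] at *; grind
  | case4 h l y h' l' ih₁ ih₂ =>
    obtain ⟨-, hv, h1, h2⟩ := hA
    obtain ⟨-, hv', h1', h2'⟩ := hB
    rw [BDD.apply, if_pos rfl]
    refine .mk (ih₁ h1 h1') (ih₂ h2 h2') fun z hz => ?_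
    have := vars_apply_subset op h h'
    have := vars_apply_subset op l l'
    grind
  | case5 x h l y h' l' h1 h2 ih₁ ih₂ =>
    obtain ⟨-, hv, h3, h4⟩ := hA
    obtain ⟨-, hv', -⟩ := id hB
    rw [BDD.apply, if_neg h1, if_pos h2]
    refine .mk (ih₁ h3 hB) (ih₂ h4 hB) fun z hz => ?_
    have := vars_apply_subset op h (node y h' l')
    have := vars_apply_subset op l (node y h' l')
    have : ∀ z ∈ vars (node y h' l'), x < z := by
      rintro z (rfl | hz)
      · exact h2
      · exact h2.trans (hv' z hz)
    grind
  | case6 x h l y h' l' h1 h2 ih₁ ih₂ =>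
    obtain ⟨-, hv, -⟩ := id hA
    obtain ⟨-, hv', h3, h4⟩ := hB
    have h2 : y < x := lt_of_le_of_ne (not_lt.1 h2) (Ne.symm h1)
    rw [BDD.apply, if_neg h1, if_neg h2.not_gt]
    refine .mk (ih₁ hA h3) (ih₂ hA h4) fun z hz => ?_
    have := vars_apply_subset op (node x h l) h'
    have := vars_apply_subset op (node x h l) l'
    have : ∀ z ∈ vars (node x h l), y < z := by
      rintro z (rfl | hz)
      · exact h2
      · exact h2.trans (hv z hz)
    grind

theorem eval_insert_of_notMem {x : V} {B : BDD V} (hx : x ∉ vars B) (σ : Finset V) :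
    eval B (insert x σ) = eval B σ :=
  eval_congr B fun y hy => by
    have : y ≠ x := by rintro rfl; exact hx hy
    simp [this]

theorem eval_erase_of_notMem {x : V} {B : BDD V} (hx : x ∉ vars B) (σ : Finset V) :
    eval B (σ.erase x) = eval B σ :=
  eval_congr B fun y hy => by
    have : y ≠ x := by rintro rfl; exact hx hy
    simp [this]

theorem IsReduced.notMem_vars {x : V} {h l : BDD V} (hB : IsReduced (node x h l)) :
    x ∉ vars h ∧ x ∉ vars l :=
  ⟨fun hx => lt_irrefl _ (hB.2.1 x (.inl hx)), fun hx => lt_irrefl _ (hB.2.1 x (.inr hx))⟩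

/-- The first child of a reduced ordered node is its cofactor at `x = 1`. -/
theorem IsReduced.eval_child1 {x : V} {h l : BDD V} (hB : IsReduced (node x h l)) (σ : Finset V) :
    eval h σ = eval (node x h l) (insert x σ) := by
  simp [eval, eval_insert_of_notMem hB.notMem_vars.1]

/-- The second child of a reduced ordered node is its cofactor at `x = 0`. -/
theorem IsReduced.eval_child0 {x : V} {h l : BDD V} (hB : IsReduced (node x h l)) (σ : Finset V) :
    eval l σ = eval (node x h l) (σ.erase x) := by
  simp [eval, eval_erase_of_notMem hB.notMem_vars.2]

/-- Canonicity: reduced ordered diagrams of the same Boolean function are equal. -/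
theorem IsReduced.eq_of_eval_eq {A B : BDD V} (hA : IsReduced A) (hB : IsReduced B)
    (h : ∀ σ, eval A σ = eval B σ) : A = B := by
  -- If `A` does not depend on the root variable of a node, both children have the function of `A`.
  have key : ∀ (A : BDD V) (y : V) (h l : BDD V), IsReduced A → IsReduced (node y h l) →
      y ∉ vars A → (∀ σ, eval A σ = eval (node y h l) σ) →
      ∀ σ, eval h σ = eval l σ := by
    intro A y h l _ hB hy he σ
    rw [hB.eval_child1, hB.eval_child0, ← he, ← he, eval_insert_of_notMem hy,
      eval_erase_of_notMem hy]
  match A, B with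
  | leaf a, leaf b => simpa [eval] using h ∅
  | leaf a, node y h' l' =>
    exact absurd (eq_of_eval_eq hB.2.2.1 hB.2.2.2 (key _ y h' l' hA hB (by simp [vars]) h)) hB.1
  | node x h' l', leaf b =>
    exact absurd (eq_of_eval_eq hA.2.2.1 hA.2.2.2
      (key _ x h' l' hB hA (by simp [vars]) fun σ => (h σ).symm)) hA.1
  | node x h₁ l₁, node y h₂ l₂ =>
    rcases lt_trichotomy x y with hxy | rfl | hxy
    · refine absurd (eq_of_eval_eq hA.2.2.1 hA.2.2.2
        (key _ x h₁ l₁ hB hA ?_ fun σ => (h σ).symm)) hA.1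
      rintro (rfl | hx)
      · exact lt_irrefl _ hxy
      · exact lt_asymm hxy (hB.2.1 x hx)
    · rw [eq_of_eval_eq hA.2.2.1 hB.2.2.1 fun σ => by
          rw [hA.eval_child1, hB.eval_child1, h],
        eq_of_eval_eq hA.2.2.2 hB.2.2.2 fun σ => by
          rw [hA.eval_child0, hB.eval_child0, h]]
    · refine absurd (eq_of_eval_eq hB.2.2.1 hB.2.2.2 (key _ y h₂ l₂ hA hB ?_ h)) hB.1
      rintro (rfl | hx)
      · exact lt_irrefl _ hxy
      · exact lt_asymm hxy (hA.2.1 y hx)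
  termination_by sizeOf A + sizeOf B

theorem eval_and (A B : BDD V) (σ : Finset V) :
    eval (and A B) σ = true ↔ eval A σ = true ∧ eval B σ = true := by
  simp [and, eval_apply]

theorem eval_or (A B : BDD V) (σ : Finset V) :
    eval (or A B) σ = true ↔ eval A σ = true ∨ eval B σ = true := by
  simp [or, eval_apply]

theorem eval_var (x : V) (σ : Finset V) : eval (var x) σ = true ↔ x ∈ σ := by
  simp [var, eval]

theorem eval_conj (L : List (BDD V)) (σ : Finset V) :
    eval (conj L) σ = true ↔ ∀ A ∈ L, eval A σ = true := by
  induction L with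
  | nil => simp [conj, eval]
  | cons A L ih => simpa [conj, eval_and] using fun _ => ih

theorem eval_disj (L : List (BDD V)) (σ : Finset V) :
    eval (disj L) σ = true ↔ ∃ A ∈ L, eval A σ = true := by
  induction L with
  | nil => simp [disj, eval]
  | cons A L ih => simpa [disj, eval_or] using or_congr_right ih

theorem IsReduced.and {A B : BDD V} (hA : IsReduced A) (hB : IsReduced B) : IsReduced (and A B) :=
  hA.apply _ hB

theorem IsReduced.or {A B : BDD V} (hA : IsReduced A) (hB : IsReduced B) : IsReduced (or A B) :=
  hA.apply _ hB

theorem IsReduced.conj {L : List (BDD V)} (hL : ∀ A ∈ L, IsReduced A) : IsReduced (conj L) := by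
  induction L with
  | nil => trivial
  | cons A L ih =>
    exact .and (hL A (by simp)) (ih fun B hB => hL B (by simp [hB]))

theorem IsReduced.disj {L : List (BDD V)} (hL : ∀ A ∈ L, IsReduced A) : IsReduced (disj L) := by
  induction L with
  | nil => trivial
  | cons A L ih =>
    exact .or (hL A (by simp)) (ih fun B hB => hL B (by simp [hB]))

/-- For reduced ordered diagrams, the equality test `A ∨ B = A` decides implication. -/
theorem IsReduced.or_eq_left_iff {A B : BDD V} (hA : IsReduced A) (hB : IsReduced B) :
    BDD.or A B = A ↔ ∀ σ, eval B σ = true → eval A σ = true := by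
  constructor
  · intro h σ hσ
    rw [← h, eval_or]
    exact .inr hσ
  · intro h
    refine (hA.or hB).eq_of_eval_eq hA fun σ => ?_
    rw [Bool.eq_iff_iff, eval_or]
    exact ⟨fun h' => h'.elim id (h σ), .inl⟩

end BDD

/-! ### Probability of a diagram -/

/-- The expectation of `f` over the subsets of `s`, to which each `i ∈ s` belongs independently with
probability `p i`. -/
def expect {V : Type*} [DecidableEq V] (p : V → ℝ) (s : Finset V) (f : Finset V → ℝ) : ℝ :=
  ∑ σ ∈ s.powerset, ((∏ i ∈ σ, p i) * ∏ i ∈ s \ σ, (1 - p i)) * f σ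

section Expect

variable {V : Type*} [DecidableEq V] {p : V → ℝ} {s : Finset V} {x : V}

/-- Conditioning on whether `x` is selected. -/
theorem expect_insert (hx : x ∉ s) (f : Finset V → ℝ) :
    expect p (insert x s) f =
      p x * expect p s (fun σ => f (insert x σ)) + (1 - p x) * expect p s f := by
  unfold expect
  rw [Finset.sum_powerset_insert hx, add_comm, Finset.mul_sum, Finset.mul_sum]
  congr 1 <;> refine Finset.sum_congr rfl fun σ hσ => ?_
  · have hσ' := Finset.mem_powerset.1 hσ
    have h1 : x ∉ σ := fun h => hx (hσ' h)
    have h2 : insert x s \ insert x σ = s \ σ := by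
      ext y; simp only [Finset.mem_sdiff, Finset.mem_insert]; grind
    rw [Finset.prod_insert h1, h2]
    ring
  · have hσ' := Finset.mem_powerset.1 hσ
    have h1 : x ∉ σ := fun h => hx (hσ' h)
    rw [Finset.insert_sdiff_of_notMem _ h1, Finset.prod_insert (by simp [hx])]
    ring

theorem expect_congr {f g : Finset V → ℝ} (h : ∀ σ, σ ⊆ s → f σ = g σ) :
    expect p s f = expect p s g :=
  Finset.sum_congr rfl fun σ hσ => by rw [h σ (Finset.mem_powerset.1 hσ)]

theorem expect_insert_of_indep (hx : x ∉ s) {f : Finset V → ℝ}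
    (hf : ∀ σ, f (insert x σ) = f σ) : expect p (insert x s) f = expect p s f := by
  rw [expect_insert hx]
  simp only [hf]
  ring

theorem expect_const_one (s : Finset V) : expect p s (fun _ => 1) = 1 := by
  induction s using Finset.induction_on with
  | empty => simp [expect]
  | insert x s hx ih => rw [expect_insert_of_indep hx fun _ => rfl, ih]

/-- Elements of probability one can be taken as always selected. -/
theorem expect_union_of_one (t : Finset V) (ht : ∀ i ∈ t, p i = 1) (hst : Disjoint s t)
    (f : Finset V → ℝ) : expect p (s ∪ t) f = expect p s fun σ => f (σ ∪ t) := by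
  induction t using Finset.induction_on generalizing f with
  | empty => simp
  | insert x t hx ih =>
    have hxs : x ∉ s := fun h => Finset.disjoint_left.1 hst h (by simp)
    rw [Finset.union_insert, expect_insert (by simp [hx, hxs]), ht x (by simp),
      ih (fun i hi => ht i (by simp [hi]))
        (hst.mono_right (Finset.subset_insert _ _))]
    simp [Finset.union_insert]

end Expect

/-- `Prob` of a reduced ordered diagram is the probability that its Boolean function is true. -/
theorem BDD.IsReduced.prob_eq_expect {V : Type*} [LinearOrder V] [Fintype V] (p : V → ℝ)
    {B : BDD V} (hB : B.IsReduced) :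
    B.prob p = expect p Finset.univ fun σ => if B.eval σ = true then 1 else 0 := by
  induction B with
  | leaf b => cases b <;> simp [prob, eval, expect_const_one]; simp [expect]
  | node x h l ih₁ ih₂ =>
    have hx := hB.notMem_vars
    obtain ⟨s, hs, hu⟩ : ∃ s : Finset V, x ∉ s ∧ Finset.univ = insert x s :=
      ⟨Finset.univ.erase x, by simp, by simp⟩
    rw [prob, ih₁ hB.2.2.1, ih₂ hB.2.2.2, hu, expect_insert_of_indep hs, expect_insert_of_indep hs,
      expect_insert hs]
    · congr 2
      · exact expect_congr fun σ _ => by rw [← hB.eval_child1]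
      · refine expect_congr fun σ hσ => ?_
        have : x ∉ σ := fun h => hs (hσ h)
        simp [eval, this]
    · exact fun σ => by rw [eval_insert_of_notMem hx.2]
    · exact fun σ => by rw [eval_insert_of_notMem hx.1]

/-- The set of axioms selected by `σ`; certain axioms are not treated specially. -/
def ProbKB.selected {NC NR NI ι : Type*} (K : ProbKB NC NR NI ι) (σ : Finset ι) :
    Set (KBAxiom NC NR NI) :=
  {E | ∃ i ∈ σ, K.ax i = E}

open Classical in
/-- As certain axioms have probability one, `P(Q)` is an expectation over all sets of axioms. -/
theorem ProbKB.queryProb_eq_expect {NC NR NI ι : Type*} [Fintype ι] [LinearOrder ι]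
    (K : ProbKB NC NR NI ι) (Q : KBAxiom NC NR NI) :
    queryProb.{v} K Q =
      expect K.p Finset.univ fun σ => if Entails.{v} (K.selected σ) Q then 1 else 0 := by
  have hu : (Finset.univ : Finset ι) =
      K.probabilistic ∪ Finset.univ.filter fun i => K.ann i = none := by
    ext i
    cases h : K.ann i <;> simp [probabilistic, h]
  rw [hu, expect_union_of_one _ (fun i hi => by simp [p, (Finset.mem_filter.1 hi).2])]
  · unfold queryProb expect
    rw [Finset.sum_filter]
    refine Finset.sum_congr rfl fun σ _ => ?_
    have hw : K.world σ = K.selected (σ ∪ Finset.univ.filter fun i => K.ann i = none) := by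
      ext E
      simp [world, selected, or_comm]
    beta_reduce
    rw [← hw, mul_ite, mul_one, mul_zero, worldProb]
  · rw [Finset.disjoint_left]
    intro i hi hi'
    have h₁ := (Finset.mem_filter.1 hi).2
    rw [(Finset.mem_filter.1 hi').2] at h₁
    simp at h₁

/-! ### Semantics of concepts in negation normal form and of assertions -/

namespace Interp

variable {NC NR NI : Type*} {Δ : Type v}

/-- The semantics of concepts in negation normal form; the extra atomic concept is interpreted
by `N`. -/
def nconcept (I : Interp NC NR NI Δ) (N : Set Δ) : NConcept NC NR → Set Δ
  | .top => Set.univ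
  | .bot => ∅
  | .atom A => A.elim N I.con
  | .natom A => (A.elim N I.con)ᶜ
  | .inter C D => I.nconcept N C ∩ I.nconcept N D
  | .union C D => I.nconcept N C ∪ I.nconcept N D
  | .ex R C => {x | ∃ y, I.role R x y ∧ y ∈ I.nconcept N C}
  | .all R C => {x | ∀ y, I.role R x y → y ∈ I.nconcept N C}

theorem nconcept_nnf (I : Interp NC NR NI Δ) (N : Set Δ) (C : Concept NC NR) :
    I.nconcept N (C.nnf true) = I.concept C ∧ I.nconcept N (C.nnf false) = (I.concept C)ᶜ := by
  induction C with
  | top => simp [Concept.nnf, nconcept, concept]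
  | bot => simp [Concept.nnf, nconcept, concept]
  | atom A => simp [Concept.nnf, nconcept, concept]
  | neg C ih => simp [Concept.nnf, concept, ih]
  | inter C D ih₁ ih₂ => simp [Concept.nnf, nconcept, concept, ih₁, ih₂, Set.compl_inter]
  | union C D ih₁ ih₂ => simp [Concept.nnf, nconcept, concept, ih₁, ih₂, Set.compl_union]
  | ex R C ih =>
    simp only [Concept.nnf, nconcept, concept, ih, true_and]
    ext x; simp
  | all R C ih =>
    simp only [Concept.nnf, nconcept, concept, ih, true_and]
    ext x; simp

@[simp] theorem nconcept_nnf_true (I : Interp NC NR NI Δ) (N : Set Δ) (C : Concept NC NR) :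
    I.nconcept N (C.nnf true) = I.concept C := (I.nconcept_nnf N C).1

@[simp] theorem nconcept_nnf_false (I : Interp NC NR NI Δ) (N : Set Δ) (C : Concept NC NR) :
    I.nconcept N (C.nnf false) = (I.concept C)ᶜ := (I.nconcept_nnf N C).2

@[simp] theorem role_inverse (I : Interp NC NR NI Δ) (R : Role NR) (x y : Δ) :
    I.role R.inverse x y ↔ I.role R y x := by
  cases R <;> rfl

/-- Truth of an assertion when the individuals of the tableau are interpreted by `π`. -/
def Models (I : Interp NC NR NI Δ) (N : Set Δ) (π : Node NI → Δ) : Assertion NC NR NI → Prop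
  | .concept x C => π x ∈ I.nconcept N C
  | .edge x y r => I.rol r (π x) (π y)

@[simp] theorem models_concept (I : Interp NC NR NI Δ) (N : Set Δ) (π : Node NI → Δ)
    (x : Node NI) (C : NConcept NC NR) :
    I.Models N π (.concept x C) ↔ π x ∈ I.nconcept N C := Iff.rfl

@[simp] theorem models_role (I : Interp NC NR NI Δ) (N : Set Δ) (π : Node NI → Δ)
    (x y : Node NI) (R : Role NR) :
    I.Models N π (.role x y R) ↔ I.role R (π x) (π y) := by
  cases R <;> rfl

theorem models_congr (I : Interp NC NR NI Δ) (N : Set Δ) {π π' : Node NI → Δ}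
    {a : Assertion NC NR NI} (h : ∀ x ∈ a.nodes, π x = π' x) :
    I.Models N π a ↔ I.Models N π' a := by
  cases a with
  | concept x C => simp [Models, h x (by simp [Assertion.nodes])]
  | edge x y r =>
    simp [Models, h x (by simp [Assertion.nodes]), h y (by simp [Assertion.nodes])]

/-- The negated query expresses that the query is false. -/
theorem exists_models_negQuery_iff [Nonempty Δ] (I : Interp NC NR NI Δ) (Q : KBAxiom NC NR NI) :
    (∃ (N : Set Δ) (π : Node NI → Δ), (∀ a, π (.named a) = I.ind a) ∧
      ∀ a ∈ negQuery Q, I.Models N π a) ↔ ¬ I.Satisfies Q := by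
  constructor
  · rintro ⟨N, π, hπ, h⟩ hQ
    cases Q with
    | trans R =>
      simp only [negQuery, Finset.mem_insert, Finset.mem_singleton, forall_eq_or_imp, forall_eq,
        models_role, models_concept] at h
      exact h.2.2.2 _ (hQ _ _ _ h.1 h.2.1) h.2.2.1
    | roleIncl R S =>
      simp only [negQuery, Finset.mem_insert, Finset.mem_singleton, forall_eq_or_imp, forall_eq,
        models_role, models_concept] at h
      exact h.2.2 _ (hQ _ _ h.1) h.2.1
    | conceptIncl C D =>
      simp only [negQuery, Finset.mem_singleton, forall_eq, Models, nconcept,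
        nconcept_nnf_true, nconcept_nnf_false] at h
      exact h.2 (hQ h.1)
    | conceptMem a C =>
      simp only [negQuery, Finset.mem_singleton, forall_eq, Models, nconcept_nnf_false, hπ] at h
      exact h hQ
    | roleMem a b r =>
      simp only [negQuery, Finset.mem_insert, Finset.mem_singleton, forall_eq_or_imp, forall_eq,
        Models] at h
      refine h.2 _ ?_ h.1
      rw [hπ, hπ]
      exact hQ
  · intro hQ
    inhabit Δ
    -- The individuals introduced for the query are mapped to a counterexample, and the extra concept
    -- to the singleton that is not reached.
    let πq (q : ℕ → Δ) : Node NI → Δ := fun x =>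
      match x with
      | .named a => I.ind a
      | .query k => q k
      | .anon _ _ => default
    cases Q with
    | trans R =>
      simp only [Satisfies, not_forall] at hQ
      obtain ⟨x, y, z, hxy, hyz, hxz⟩ := hQ
      refine ⟨{z}, πq fun k => if k = 0 then x else if k = 1 then y else z, fun _ => rfl, ?_⟩
      simp only [negQuery, Finset.mem_insert, Finset.mem_singleton, forall_eq_or_imp, forall_eq,
        models_role, models_concept]
      refine ⟨hxy, hyz, rfl, ?_⟩
      rintro w hw (rfl : w = z)
      exact hxz hw
    | roleIncl R S =>
      simp only [Satisfies, not_forall] at hQ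
      obtain ⟨x, y, hxy, hxz⟩ := hQ
      refine ⟨{y}, πq fun k => if k = 0 then x else y, fun _ => rfl, ?_⟩
      simp only [negQuery, Finset.mem_insert, Finset.mem_singleton, forall_eq_or_imp, forall_eq,
        models_role, models_concept]
      refine ⟨hxy, rfl, ?_⟩
      rintro w hw (rfl : w = y)
      exact hxz hw
    | conceptIncl C D =>
      obtain ⟨x, hx, hx'⟩ := Set.not_subset.1 hQ
      refine ⟨∅, πq fun _ => x, fun _ => rfl, ?_⟩
      simp only [negQuery, Finset.mem_singleton, forall_eq, Models, nconcept,
        nconcept_nnf_true, nconcept_nnf_false]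
      exact ⟨hx, hx'⟩
    | conceptMem a C =>
      refine ⟨∅, πq default, fun _ => rfl, ?_⟩
      simp only [negQuery, Finset.mem_singleton, forall_eq, Models, nconcept_nnf_false]
      exact hQ
    | roleMem a b r =>
      refine ⟨{I.ind b}, πq default, fun _ => rfl, ?_⟩
      simp only [negQuery, Finset.mem_insert, Finset.mem_singleton, forall_eq_or_imp, forall_eq,
        Models]
      refine ⟨rfl, ?_⟩
      rintro w hw (rfl : w = I.ind b)
      exact hQ hw

theorem Satisfies.models {I : Interp NC NR NI Δ} {N : Set Δ} {π : Node NI → Δ}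
    (hπ : ∀ a, π (.named a) = I.ind a) {E : KBAxiom NC NR NI} (hE : I.Satisfies E)
    {a : Assertion NC NR NI} (ha : a ∈ E.assertion) : I.Models N π a := by
  cases E <;> simp [KBAxiom.assertion] at ha <;> subst ha <;> simpa [Models, hπ] using! hE

end Interp

/-! ### Valuations of a tableau -/

namespace Tableau

variable {NC NR NI ι : Type*} [LinearOrder ι]

/-- The assertion `a` belongs to the tableau that `T` denotes under the valuation `σ`. -/
def Holds (T : Tableau NC NR NI ι) (σ : Finset ι) (a : Assertion NC NR NI) : Prop :=
  a ∈ T.assertions ∧ (T.lab a).eval σ = true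

theorem mem_ins {T : Tableau NC NR NI ι} {ψ : BDD ι} {B : Finset (Assertion NC NR NI)}
    {a : Assertion NC NR NI} : a ∈ T.ins ψ B ↔ a ∈ B ∧ T.Insertable ψ a := by
  simp [ins]

theorem mem_insertion {T : Tableau NC NR NI ι} {ψ : BDD ι} {B : Finset (Assertion NC NR NI)}
    {a : Assertion NC NR NI} : a ∈ (T.insertion ψ B).assertions ↔ a ∈ T.assertions ∨ a ∈ B := by
  simp only [insertion, Finset.mem_union, mem_ins, Insertable]
  tauto

/-- Under a valuation, `ψ`-insertion adds the whole set if `ψ` is true and nothing otherwise: a member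
that is not `ψ`-insertable holds already whenever `ψ` is true. -/
theorem holds_insertion {T : Tableau NC NR NI ι} {ψ : BDD ι} {B : Finset (Assertion NC NR NI)}
    {σ : Finset ι} {a : Assertion NC NR NI} :
    (T.insertion ψ B).Holds σ a ↔ T.Holds σ a ∨ a ∈ B ∧ ψ.eval σ = true := by
  rw [Holds, mem_insertion]
  by_cases ha : a ∈ T.ins ψ B
  · by_cases haT : a ∈ T.assertions
    · simp [insertion, ha, haT, BDD.eval_or, Holds, (mem_ins.1 ha).1]
    · simp [insertion, ha, haT, Holds, (mem_ins.1 ha).1]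
  · by_cases haB : a ∈ B
    · have h := ha
      rw [mem_ins, Insertable] at h
      push Not at h
      obtain ⟨haT, hl⟩ := h haB
      have : ψ.eval σ = true → (T.lab a).eval σ = true := fun h' => by
        rw [← hl, BDD.eval_or]
        exact .inr h'
      simp only [insertion, ha, haT, Holds, haB]
      simpa using this
    · simp [insertion, ha, haB, Holds]

theorem Holds.mem_nodes {T : Tableau NC NR NI ι} {σ : Finset ι} {a : Assertion NC NR NI}
    (h : T.Holds σ a) {x : Node NI} (hx : x ∈ a.nodes) : x ∈ T.nodes := by
  simp only [nodes, Finset.mem_biUnion]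
  exact ⟨a, h.1, hx⟩

theorem eval_clashBDD {T : Tableau NC NR NI ι} {σ : Finset ι} :
    T.clashBDD.eval σ = true ↔ (∃ x, T.Holds σ (.concept x .bot)) ∨
      ∃ x A, T.Holds σ (.concept x (.atom A)) ∧ T.Holds σ (.concept x (.natom A)) := by
  simp only [clashBDD, BDD.eval_disj, List.mem_map, Finset.mem_toList]
  constructor
  · rintro ⟨_, ⟨a, ha, rfl⟩, h⟩
    unfold clashLabel at h
    split at h
    · exact .inl ⟨_, ha, h⟩
    · split_ifs at h with h'
      · rw [BDD.eval_and] at h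
        exact .inr ⟨_, _, ⟨h', h.2⟩, ha, h.1⟩
      · cases h
    · cases h
  · rintro (⟨x, h⟩ | ⟨x, A, h, h'⟩)
    · exact ⟨_, ⟨_, h.1, rfl⟩, h.2⟩
    · refine ⟨_, ⟨_, h'.1, rfl⟩, ?_⟩
      simp only [clashLabel, h.1, if_true, BDD.eval_and]
      exact ⟨h'.2, h.2⟩

end Tableau

namespace ProbKB

section

variable {NC NR NI ι : Type*} [LinearOrder ι]

theorem eval_psi {T : Tableau NC NR NI ι} {B₀ : Finset (Assertion NC NR NI)} {E σ : Finset ι} :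
    (psi T B₀ E).eval σ = true ↔ (∀ a ∈ B₀, (T.lab a).eval σ = true) ∧ E ⊆ σ := by
  simp [psi, BDD.eval_and, BDD.eval_conj, BDD.eval_var, Finset.subset_iff]

theorem eval_finalBDD {F : List (Tableau NC NR NI ι)} {σ : Finset ι} :
    (finalBDD F).eval σ = true ↔ ∀ T ∈ F, T.clashBDD.eval σ = true := by
  simp [finalBDD, BDD.eval_conj]

theorem holds_initial [Fintype ι] {K : ProbKB NC NR NI ι} {Q : KBAxiom NC NR NI} {σ : Finset ι}
    {a : Assertion NC NR NI} :
    (K.initial Q).Holds σ a ↔ a ∈ negQuery Q ∨ ∃ i ∈ σ, a ∈ (K.ax i).assertion := by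
  have key : ∀ (L : List ι) (T : Tableau NC NR NI ι),
      (L.foldl (fun T i => T.insertion (BDD.var i) (K.ax i).assertion) T).Holds σ a ↔
        T.Holds σ a ∨ ∃ i ∈ L, i ∈ σ ∧ a ∈ (K.ax i).assertion := by
    intro L
    induction L with
    | nil => simp
    | cons i L ih =>
      intro T
      simp only [List.foldl_cons, ih, Tableau.holds_insertion, BDD.eval_var, List.mem_cons]
      grind
  rw [initial, key]
  simp [Tableau.Holds, BDD.eval]

end

/-! ### Soundness: a model of the selected axioms and the negated query survives every rule -/

theorem SubRole.sound {NC NR NI ι : Type*} {K : ProbKB NC NR NI ι} {Δ : Type v}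
    {I : Interp NC NR NI Δ} {σ : Finset ι} (hI : ∀ i ∈ σ, I.Satisfies (K.ax i)) {E : Finset ι}
    (hE : E ⊆ σ) {R S : Role NR} (h : K.SubRole E R S) {x y : Δ} (hxy : I.role R x y) :
    I.role S x y := by
  induction h with
  | refl => exact hxy
  | tail _ h ih =>
    obtain ⟨i, hi, h | h⟩ := h
    · have := hI i (hE hi)
      rw [h] at this
      exact this _ _ ih
    · have := hI i (hE hi)
      rw [h] at this
      simpa using this y x (by simpa using ih)

theorem RuleInst.sound {NC NR NI ι : Type*} {K : ProbKB NC NR NI ι} {Δ : Type v} {I : Interp NC NR NI Δ}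
    {N : Set Δ} {T : Tableau NC NR NI ι} {σ : Finset ι}
    (hI : ∀ i ∈ σ, I.Satisfies (K.ax i)) {π : Node NI → Δ} {B₀ : Finset (Assertion NC NR NI)}
    {E : Finset ι} {Bs : List (Finset (Assertion NC NR NI))} (h : K.RuleInst T B₀ E Bs)
    (hE : E ⊆ σ) (hB₀ : ∀ a ∈ B₀, I.Models N π a) :
    ∃ B ∈ Bs, ∀ a ∈ B, I.Models N π a := by
  cases h with
  | unfold x A D i hi =>
    have := hI i (hE (by simp))
    rw [hi] at this
    simpa [Interp.Models] using this (hB₀ (.concept x (.atom (some A))) (by simp))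
  | ce C D i hC hi =>
    have := hI i (hE (by simp))
    rw [hi] at this
    simp only [List.mem_singleton, exists_eq_left, Finset.mem_image, forall_exists_index, and_imp]
    rintro _ x - rfl
    by_cases hx : π x ∈ I.concept C
    · exact .inr (by simpa using this hx)
    · exact .inl (by simpa using hx)
  | inter x C D =>
    simpa [Interp.Models] using! hB₀ (.concept x (.inter C D)) (by simp)
  | union x C D =>
    simpa [Interp.Models] using! hB₀ (.concept x (.union C D)) (by simp)
  | univ x y R₀ S C E hS =>
    have h₁ := hB₀ (.concept x (.all S C)) (by simp)
    have h₂ := hB₀ (.role x y R₀) (by simp)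
    rw [Interp.models_role] at h₂
    simpa [Interp.Models] using h₁ _ (hS.sound hI hE h₂)
  | univPlus x y R₀ R S C E i hR hS hi =>
    have hE' : E ⊆ σ := fun j hj => hE (by simp [hj])
    have h₁ := hB₀ (.concept x (.all S C)) (by simp)
    have h₂ := hB₀ (.role x y R₀) (by simp)
    rw [Interp.models_role] at h₂
    have hR' := hR.sound hI hE' h₂
    have htr : ∀ x y z, I.role R x y → I.role R y z → I.role R x z := by
      have := hI i (hE (by simp))
      rcases hi with hi | hi <;> rw [hi] at this
      · exact this
      · exact fun x y z h h' => by simpa using this z y x (by simpa using h') (by simpa using h)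
    simp only [List.mem_singleton, exists_eq_left, Finset.mem_singleton, forall_eq, Interp.Models]
    exact fun z hz => h₁ _ (hS.sound hI hE' (htr _ _ _ hR' hz))

variable {NC NR NI ι : Type*} [LinearOrder ι]

/-- The tableau that `T` denotes under `σ` is true in `I` for some interpretation of the
individuals of the tableau. -/
def Realizes {Δ : Type v} (I : Interp NC NR NI Δ) (N : Set Δ) (T : Tableau NC NR NI ι)
    (σ : Finset ι) : Prop :=
  ∃ π : Node NI → Δ, (∀ a, π (.named a) = I.ind a) ∧ ∀ a, T.Holds σ a → I.Models N π a

/-- Of the tableaux that replace a realized one, at least one is realized. -/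
theorem Realizes.expands {K : ProbKB NC NR NI ι} {Δ : Type v} {I : Interp NC NR NI Δ}
    {N : Set Δ} {T : Tableau NC NR NI ι} {σ : Finset ι} (hT : Realizes I N T σ)
    (hI : ∀ i ∈ σ, I.Satisfies (K.ax i)) {Ts : List (Tableau NC NR NI ι)}
    (h : K.Expands T Ts) : ∃ T' ∈ Ts, Realizes I N T' σ := by
  obtain ⟨π, hπ, hT⟩ := hT
  cases h with
  | rule B₀ E Bs hrule hB₀ happ =>
    -- If `ψ` is false under `σ`, the new tableaux denote what `T` denotes.
    by_cases hψ : (psi T B₀ E).eval σ = true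
    · have hψ' := eval_psi.1 hψ
      obtain ⟨B, hB, hm⟩ := hrule.sound (N := N) (π := π) hI hψ'.2
        fun a ha => hT a ⟨hB₀ ha, hψ'.1 a ha⟩
      refine ⟨_, List.mem_map_of_mem hB, π, hπ, fun a ha => ?_⟩
      rcases Tableau.holds_insertion.1 ha with ha | ha
      · exact hT a ha
      · exact hm a ha.1
    · obtain ⟨B, hB⟩ : ∃ B, B ∈ Bs := by
        cases hrule <;> exact ⟨_, List.mem_cons_self⟩
      refine ⟨_, List.mem_map_of_mem hB, π, hπ, fun a ha => ?_⟩
      rcases Tableau.holds_insertion.1 ha with ha | ha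
      · exact hT a ha
      · exact absurd ha.2 hψ
  | ex x S C k hx hblock happ hfresh =>
    simp only [List.mem_singleton, exists_eq_left]
    classical
    -- The generated individual is interpreted by a witness of `∃S.C` if there is one.
    obtain ⟨d, hd⟩ : ∃ d, (T.lab (.concept x (.ex S C))).eval σ = true →
        I.role S (π x) d ∧ d ∈ I.nconcept N C := by
      by_cases hψ : (T.lab (.concept x (.ex S C))).eval σ = true
      · obtain ⟨d, hd⟩ := hT _ ⟨hx, hψ⟩
        exact ⟨d, fun _ => hd⟩
      · exact ⟨π x, fun h => absurd h hψ⟩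
    have hxk : x ≠ .anon x k := fun h => by
      have := congrArg sizeOf h
      simp only [Node.anon.sizeOf_spec] at this
      lia
    refine ⟨Function.update π (.anon x k) d, fun a => ?_, fun a ha => ?_⟩
    · rw [Function.update_of_ne (by simp), hπ]
    · rcases Tableau.holds_insertion.1 ha with ha | ⟨ha, hψ⟩
      · rw [← I.models_congr N fun y hy => ?_]
        · exact hT a ha
        · rw [Function.update_of_ne]
          rintro rfl
          exact hfresh (ha.mem_nodes hy)
      · simp only [Finset.mem_insert, Finset.mem_singleton] at ha
        rcases ha with rfl | rfl
        · simpa [hxk] using (hd hψ).1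
        · simpa [Interp.Models] using (hd hψ).2

theorem Realizes.reach {K : ProbKB NC NR NI ι} {Δ : Type v} {I : Interp NC NR NI Δ}
    {N : Set Δ} {σ : Finset ι} (hI : ∀ i ∈ σ, I.Satisfies (K.ax i))
    {F F' : List (Tableau NC NR NI ι)} (h : Relation.ReflTransGen K.Step F F')
    (hF : ∃ T ∈ F, Realizes I N T σ) : ∃ T ∈ F', Realizes I N T σ := by
  induction h with
  | refl => exact hF
  | tail _ h ih =>
    obtain ⟨F₁, F₂, Ts, T, h⟩ := h
    obtain ⟨T', hT', hr⟩ := ih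
    rw [List.mem_append, List.mem_cons] at hT'
    rcases hT' with hT' | rfl | hT'
    · exact ⟨T', by simp [hT'], hr⟩
    · obtain ⟨T'', hT'', hr⟩ := hr.expands hI h
      exact ⟨T'', by simp [hT''], hr⟩
    · exact ⟨T', by simp [hT'], hr⟩

theorem Realizes.clashBDD_eval {Δ : Type v} {I : Interp NC NR NI Δ}
    {N : Set Δ} {T : Tableau NC NR NI ι} {σ : Finset ι} (hT : Realizes I N T σ) :
    ¬ T.clashBDD.eval σ = true := by
  obtain ⟨π, -, hT⟩ := hT
  rw [Tableau.eval_clashBDD]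
  rintro (⟨x, h⟩ | ⟨x, A, h, h'⟩)
  · exact hT _ h
  · exact hT _ h' (hT _ h)

/-- Soundness: if the final BDD of a forest is true under `σ`, the axioms selected by `σ` entail
the query. -/
theorem entails_of_eval_finalBDD [Fintype ι] {K : ProbKB NC NR NI ι} {Q : KBAxiom NC NR NI}
    {F : List (Tableau NC NR NI ι)} (h : Relation.ReflTransGen K.Step [K.initial Q] F)
    {σ : Finset ι} (hσ : (finalBDD F).eval σ = true) : Entails.{v} (K.selected σ) Q := by
  intro Δ _ I hI
  have hI' : ∀ i ∈ σ, I.Satisfies (K.ax i) := fun i hi => hI _ ⟨i, hi, rfl⟩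
  by_contra hQ
  obtain ⟨N, π, hπ, hm⟩ := (I.exists_models_negQuery_iff Q).2 hQ
  obtain ⟨T, hT, hr⟩ := Realizes.reach (N := N) hI' h ⟨_, List.mem_singleton_self _, π, hπ,
    fun a ha => by
      rcases holds_initial.1 ha with ha | ⟨i, hi, ha⟩
      · exact hm a ha
      · exact (hI' i hi).models hπ ha⟩
  exact hr.clashBDD_eval (eval_finalBDD.1 hσ T hT)

end ProbKB

/-! ### Invariants of runs -/

/-- The individuals that are not generated by the `∃`-rule. -/
def Node.IsRoot {NI : Type*} : Node NI → Prop
  | .anon _ _ => False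
  | _ => True

namespace Tableau

variable {NC NR NI ι : Type*}

/-- Every role assertion links two roots, or an individual and its parent. -/
def TreeShaped (T : Tableau NC NR NI ι) : Prop :=
  ∀ x y r, .edge x y r ∈ T.assertions →
    x.IsRoot ∧ y.IsRoot ∨ (∃ k, y = .anon x k) ∨ ∃ k, x = .anon y k

theorem TreeShaped.role {T : Tableau NC NR NI ι} (hT : T.TreeShaped) {x y : Node NI}
    {R : Role NR} (h : .role x y R ∈ T.assertions) :
    x.IsRoot ∧ y.IsRoot ∨ (∃ k, y = .anon x k) ∨ ∃ k, x = .anon y k := by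
  cases R with
  | atom r => exact hT _ _ r h
  | inv r =>
    have := hT _ _ r h
    tauto

theorem not_blocked_of_isRoot {T : Tableau NC NR NI ι} {x : Node NI} (hx : x.IsRoot) :
    ¬ T.Blocked x := by
  cases x <;> simp_all [Blocked, Node.IsRoot]

theorem mem_nodes {T : Tableau NC NR NI ι} {x : Node NI} :
    x ∈ T.nodes ↔ ∃ a ∈ T.assertions, x ∈ a.nodes := by
  simp [nodes]

end Tableau

@[simp] theorem Assertion.mem_nodes_concept {NC NR NI : Type*} {x y : Node NI}
    {C : NConcept NC NR} : y ∈ (Assertion.concept x C : Assertion NC NR NI).nodes ↔ y = x := by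
  simp [nodes]

@[simp] theorem Assertion.mem_nodes_role {NC NR NI : Type*} {x y z : Node NI} {R : Role NR} :
    z ∈ (Assertion.role x y R : Assertion NC NR NI).nodes ↔ z = x ∨ z = y := by
  cases R <;> simp [nodes, role, or_comm]

theorem isRoot_of_mem_negQuery {NC NR NI : Type*} {Q : KBAxiom NC NR NI}
    {a : Assertion NC NR NI} (ha : a ∈ negQuery Q) {x : Node NI} (hx : x ∈ a.nodes) :
    x.IsRoot := by
  cases Q <;> simp only [negQuery, Finset.mem_insert, Finset.mem_singleton] at ha <;>
    rcases ha with rfl | rfl | rfl | rfl <;> simp at hx <;> rcases hx with rfl | rfl <;> trivial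

theorem isRoot_of_mem_assertion {NC NR NI : Type*} {E : KBAxiom NC NR NI}
    {a : Assertion NC NR NI} (ha : a ∈ E.assertion) {x : Node NI} (hx : x ∈ a.nodes) :
    x.IsRoot := by
  cases E <;> simp [KBAxiom.assertion] at ha <;> subst ha <;>
    simp [Assertion.nodes] at hx <;> rcases hx with rfl | rfl <;> trivial

namespace ProbKB

/-- The rules that generate no individual add concept assertions about present individuals only. -/
theorem RuleInst.exists_eq_concept {NC NR NI ι : Type*} {K : ProbKB NC NR NI ι}
    {T : Tableau NC NR NI ι} {B₀ : Finset (Assertion NC NR NI)}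
    {E : Finset ι} {Bs : List (Finset (Assertion NC NR NI))} (h : K.RuleInst T B₀ E Bs)
    (hB₀ : B₀ ⊆ T.assertions) {B : Finset (Assertion NC NR NI)} (hB : B ∈ Bs)
    {a : Assertion NC NR NI} (ha : a ∈ B) : ∃ x ∈ T.nodes, ∃ C, a = .concept x C := by
  have hn : ∀ x b, b ∈ B₀ → x ∈ b.nodes → x ∈ T.nodes := fun x b hb hx =>
    Tableau.mem_nodes.2 ⟨b, hB₀ hb, hx⟩
  cases h with
  | unfold x A D i hi =>
    simp only [List.mem_singleton] at hB; subst hB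
    simp only [Finset.mem_singleton] at ha
    exact ⟨x, hn x (.concept x (.atom (some A))) (by simp) (by simp), _, ha⟩
  | ce C D i hC hi =>
    simp only [List.mem_singleton] at hB; subst hB
    simp only [Finset.mem_image] at ha
    obtain ⟨x, hx, rfl⟩ := ha
    exact ⟨x, hx, _, rfl⟩
  | inter x C D =>
    simp only [List.mem_singleton] at hB; subst hB
    simp only [Finset.mem_insert, Finset.mem_singleton] at ha
    refine ⟨x, hn x (.concept x (.inter C D)) (by simp) (by simp), ?_⟩
    rcases ha with rfl | rfl <;> exact ⟨_, rfl⟩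
  | union x C D =>
    refine ⟨x, hn x (.concept x (.union C D)) (by simp) (by simp), ?_⟩
    simp only [List.mem_cons, List.not_mem_nil, or_false] at hB
    rcases hB with rfl | rfl <;> simp only [Finset.mem_singleton] at ha <;> exact ⟨_, ha⟩
  | univ x y R₀ S C E hS =>
    simp only [List.mem_singleton] at hB; subst hB
    simp only [Finset.mem_singleton] at ha
    exact ⟨y, hn y (.role x y R₀) (by simp) (by simp), _, ha⟩
  | univPlus x y R₀ R S C E i hR hS hi =>
    simp only [List.mem_singleton] at hB; subst hB
    simp only [Finset.mem_singleton] at ha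
    exact ⟨y, hn y (.role x y R₀) (by simp) (by simp), _, ha⟩

variable {NC NR NI ι : Type*} [LinearOrder ι]

/-- A property of tableaux that rules preserve holds in all forests of a run. -/
theorem forall_mem_of_reach {K : ProbKB NC NR NI ι} {P : Tableau NC NR NI ι → Prop}
    (hP : ∀ T Ts, P T → K.Expands T Ts → ∀ T' ∈ Ts, P T') {F F' : List (Tableau NC NR NI ι)}
    (h : Relation.ReflTransGen K.Step F F') (hF : ∀ T ∈ F, P T) : ∀ T ∈ F', P T := by
  induction h with
  | refl => exact hF
  | tail _ h ih =>
    obtain ⟨F₁, F₂, Ts, T, h⟩ := h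
    intro T' hT'
    simp only [List.mem_append, List.mem_cons] at ih hT'
    rcases hT' with (hT' | hT') | hT'
    · exact ih _ (.inl hT')
    · exact hP T Ts (ih _ (.inr (.inl rfl))) h T' hT'
    · exact ih _ (.inr (.inr hT'))

theorem mem_assertions_initial [Fintype ι] {K : ProbKB NC NR NI ι} {Q : KBAxiom NC NR NI}
    {a : Assertion NC NR NI} :
    a ∈ (K.initial Q).assertions ↔ a ∈ negQuery Q ∨ ∃ i, a ∈ (K.ax i).assertion := by
  have key : ∀ (L : List ι) (T : Tableau NC NR NI ι),
      a ∈ (L.foldl (fun T i => T.insertion (BDD.var i) (K.ax i).assertion) T).assertions ↔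
        a ∈ T.assertions ∨ ∃ i ∈ L, a ∈ (K.ax i).assertion := by
    intro L
    induction L with
    | nil => simp
    | cons i L ih =>
      intro T
      simp only [List.foldl_cons, ih, Tableau.mem_insertion, List.mem_cons]
      grind
  rw [initial, key]
  simp

theorem isRoot_of_mem_initial [Fintype ι] {K : ProbKB NC NR NI ι} {Q : KBAxiom NC NR NI}
    {x : Node NI} (hx : x ∈ (K.initial Q).nodes) : x.IsRoot := by
  obtain ⟨a, ha, hx⟩ := Tableau.mem_nodes.1 hx
  rcases mem_assertions_initial.1 ha with ha | ⟨i, ha⟩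
  · exact isRoot_of_mem_negQuery ha hx
  · exact isRoot_of_mem_assertion ha hx

theorem treeShaped_initial [Fintype ι] (K : ProbKB NC NR NI ι) (Q : KBAxiom NC NR NI) :
    (K.initial Q).TreeShaped := fun x y r h =>
  .inl ⟨isRoot_of_mem_initial (Tableau.mem_nodes.2 ⟨_, h, by simp [Assertion.nodes]⟩),
    isRoot_of_mem_initial (Tableau.mem_nodes.2 ⟨_, h, by simp [Assertion.nodes]⟩)⟩

theorem Expands.treeShaped {K : ProbKB NC NR NI ι} {T : Tableau NC NR NI ι}
    {Ts : List (Tableau NC NR NI ι)} (hT : T.TreeShaped) (h : K.Expands T Ts) :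
    ∀ T' ∈ Ts, T'.TreeShaped := by
  cases h with
  | rule B₀ E Bs hrule hB₀ happ =>
    simp only [List.mem_map]
    rintro _ ⟨B, hB, rfl⟩ x y r hr
    rcases Tableau.mem_insertion.1 hr with hr | hr
    · exact hT x y r hr
    · obtain ⟨x, -, C, h⟩ := hrule.exists_eq_concept hB₀ hB hr
      cases h
  | ex x S C k hx hblock happ hfresh =>
    simp only [List.mem_singleton]
    rintro _ rfl y z r hr
    rcases Tableau.mem_insertion.1 hr with hr | hr
    · exact hT y z r hr
    · simp only [Finset.mem_insert, Finset.mem_singleton, reduceCtorEq, or_false] at hr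
      cases S <;> simp only [Assertion.role, Assertion.edge.injEq] at hr <;>
        obtain ⟨rfl, rfl, -⟩ := hr
      · exact .inr (.inl ⟨_, rfl⟩)
      · exact .inr (.inr ⟨_, rfl⟩)

theorem Expands.exists_insertion {K : ProbKB NC NR NI ι} {T : Tableau NC NR NI ι}
    {Ts : List (Tableau NC NR NI ι)} (h : K.Expands T Ts) :
    ∀ T' ∈ Ts, ∃ ψ B, T' = T.insertion ψ B := by
  cases h with
  | rule B₀ E Bs hrule hB₀ happ =>
    simp only [List.mem_map]
    rintro _ ⟨B, hB, rfl⟩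
    exact ⟨_, _, rfl⟩
  | ex x S C k hx hblock happ hfresh =>
    simp only [List.mem_singleton]
    rintro _ rfl
    exact ⟨_, _, rfl⟩

/-! ### Saturation of fully expanded tableaux -/

omit [LinearOrder ι] in
theorem SubRole.mono {K : ProbKB NC NR NI ι} {E E' : Finset ι} (hE : E ⊆ E') {R S : Role NR}
    (h : K.SubRole E R S) : K.SubRole E' R S :=
  Relation.ReflTransGen.mono (fun _ _ ⟨i, hi, h⟩ => ⟨i, hE hi, h⟩) _ _ h

/-- If no rule applies to `T`, the assertions that hold in `T` under `σ` are closed under the rules that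
generate no individual, for the axioms selected by `σ`. -/
theorem holds_of_not_expands {K : ProbKB NC NR NI ι} {T : Tableau NC NR NI ι}
    (hT : ∀ Ts, ¬ K.Expands T Ts) {σ E : Finset ι} {B₀ : Finset (Assertion NC NR NI)}
    {Bs : List (Finset (Assertion NC NR NI))} (h : K.RuleInst T B₀ E Bs)
    (hB₀ : ∀ a ∈ B₀, T.Holds σ a) (hE : E ⊆ σ) : ∃ B ∈ Bs, ∀ a ∈ B, T.Holds σ a := by
  by_contra! hB
  refine hT _ (.rule B₀ E Bs h (fun a ha => (hB₀ a ha).1) fun B hBs => ?_)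
  obtain ⟨a, ha, hσ⟩ := hB B hBs
  refine ⟨a, Tableau.mem_ins.2 ⟨ha, ?_⟩⟩
  by_contra hi
  rw [Tableau.Insertable] at hi
  push Not at hi
  refine hσ ⟨hi.1, ?_⟩
  rw [← hi.2, BDD.eval_or]
  exact .inr (eval_psi.2 ⟨fun b hb => (hB₀ b hb).2, hE⟩)

/-- If no rule applies to `T`, every existential restriction on an unblocked individual that holds
under `σ` has a witness under `σ`. -/
theorem exists_witness_of_not_expands {K : ProbKB NC NR NI ι} {T : Tableau NC NR NI ι}
    (hT : ∀ Ts, ¬ K.Expands T Ts) {σ : Finset ι} {x : Node NI} {S : Role NR}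
    {C : NConcept NC NR} (hx : T.Holds σ (.concept x (.ex S C))) (hb : ¬ T.Blocked x) :
    ∃ z R, K.SubRole σ R S ∧ T.Holds σ (.role x z R) ∧ T.Holds σ (.concept z C) := by
  obtain ⟨k, hk⟩ : ∃ k, Node.anon x k ∉ T.nodes := by
    by_contra! h
    exact Set.infinite_range_of_injective (f := fun k => Node.anon x k)
      (fun k l h => by simpa using h)
      (T.nodes.finite_toSet.subset (by rintro _ ⟨k, rfl⟩; exact h k))
  have : ∃ z, K.Witness T (T.lab (.concept x (.ex S C))) x z S C := by
    by_contra! h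
    exact hT _ (.ex x S C k hx.1 hb h hk)
  obtain ⟨z, ⟨R, E, hR, hz, hψ⟩, hi⟩ := this
  rw [Tableau.Insertable] at hi
  push Not at hi
  have hψσ : (psi T {.role x z R} E).eval σ = true := by
    rw [← hψ, BDD.eval_or]
    exact .inr hx.2
  rw [eval_psi] at hψσ
  refine ⟨z, R, hR.mono hψσ.2, ⟨hz, hψσ.1 _ (by simp)⟩, hi.1, ?_⟩
  rw [← hi.2, BDD.eval_or]
  exact .inr hx.2

end ProbKB

/-! ### The canonical model of a fully expanded tableau -/

namespace Tableau

variable {NC NR NI ι : Type*}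

theorem SameAnnotations.refl (T : Tableau NC NR NI ι) (x : Node NI) : T.SameAnnotations x x :=
  fun _ => ⟨Iff.rfl, fun _ => rfl⟩

theorem SameAnnotations.symm {T : Tableau NC NR NI ι} {x y : Node NI}
    (h : T.SameAnnotations x y) : T.SameAnnotations y x :=
  fun C => ⟨(h C).1.symm, fun hy => ((h C).2 ((h C).1.2 hy)).symm⟩

/-- Parents of unblocked individuals are unblocked, hence so are all predecessors. -/
theorem not_blocked_of_ancestor {T : Tableau NC NR NI ι} {x y : Node NI} (h : Ancestor x y)
    (hy : ¬ T.Blocked y) : ¬ T.Blocked x := by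
  induction y with
  | named a => exact h.elim
  | query k => exact h.elim
  | anon y k ih =>
    simp only [Blocked, not_or] at hy
    rcases h with rfl | h
    · exact hy.2
    · exact ih h hy.2

/-- A neighbour of an unblocked individual is represented by an unblocked individual with the same
annotations: itself, or the predecessor that blocks it. -/
theorem TreeShaped.exists_not_blocked {T : Tableau NC NR NI ι} (hT : T.TreeShaped) {x z : Node NI}
    (hx : ¬ T.Blocked x) {R : Role NR} (h : .role x z R ∈ T.assertions) :
    ∃ y, ¬ T.Blocked y ∧ T.SameAnnotations z y := by
  by_cases hz : T.Blocked z
  · rcases hT.role h with ⟨-, h⟩ | ⟨k, rfl⟩ | ⟨k, rfl⟩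
    · exact absurd hz (not_blocked_of_isRoot h)
    · obtain ⟨y, hy, hs⟩ | hz := hz
      · refine ⟨y, ?_, hs.symm⟩
        rcases hy with rfl | hy
        · exact hx
        · exact not_blocked_of_ancestor hy hx
      · exact absurd hz hx
    · exact absurd (.inr hz) hx
  · exact ⟨z, hz, .refl T z⟩

variable [LinearOrder ι]

theorem SameAnnotations.holds {T : Tableau NC NR NI ι} {x y : Node NI}
    (h : T.SameAnnotations x y) {σ : Finset ι} {C : NConcept NC NR}
    (hx : T.Holds σ (.concept x C)) : T.Holds σ (.concept y C) :=
  ⟨(h C).1.1 hx.1, by rw [← (h C).2 hx.1]; exact hx.2⟩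

end Tableau

theorem Role.inverse_inverse {NR : Type*} (R : Role NR) : R.inverse.inverse = R := by
  cases R <;> rfl

theorem Assertion.role_inverse {NC NR NI : Type*} (x y : Node NI) (R : Role NR) :
    (Assertion.role x y R.inverse : Assertion NC NR NI) = .role y x R := by
  cases R <;> rfl

namespace ProbKB

section Selected

variable {NC NR NI ι : Type*}

theorem SubRole.inverse {K : ProbKB NC NR NI ι} {E : Finset ι} {R S : Role NR}
    (h : K.SubRole E R S) : K.SubRole E R.inverse S.inverse := by
  induction h with
  | refl => exact .refl
  | tail _ h ih =>
    obtain ⟨i, hi, h⟩ := h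
    exact ih.tail ⟨i, hi, by simpa only [Role.inverse_inverse] using h.symm⟩

/-- The axioms selected by `σ` declare `R` or its inverse transitive. -/
def IsTrans (K : ProbKB NC NR NI ι) (σ : Finset ι) (R : Role NR) : Prop :=
  ∃ i ∈ σ, K.ax i = .trans R ∨ K.ax i = .trans R.inverse

theorem IsTrans.inverse {K : ProbKB NC NR NI ι} {σ : Finset ι} {R : Role NR}
    (h : K.IsTrans σ R) : K.IsTrans σ R.inverse := by
  obtain ⟨i, hi, h⟩ := h
  exact ⟨i, hi, by simpa only [Role.inverse_inverse] using h.symm⟩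

end Selected

/-- The canonical model is taken over a type `Δ` whose elements stand, through `g`, for the
unblocked individuals of the tableau. -/
structure Represents {NC NR NI ι : Type*} (T : Tableau NC NR NI ι) {Δ : Type v}
    (g : Δ → Node NI) : Prop where
  mem : ∀ d, g d ∈ T.nodes
  not_blocked : ∀ d, ¬ T.Blocked (g d)
  surj : ∀ x ∈ T.nodes, ¬ T.Blocked x → ∃ d, g d = x

variable {NC NR NI ι : Type*} [LinearOrder ι] {Δ : Type v}

/-- The edges of the tableau under `σ`, up to equality of annotations; in particular edges to a
blocked individual are redirected to the individual that blocks it. -/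
def Link (T : Tableau NC NR NI ι) (σ : Finset ι) (g : Δ → Node NI) (R : Role NR) (d d' : Δ) :
    Prop :=
  ∃ x y, T.Holds σ (.role x y R) ∧ T.SameAnnotations x (g d) ∧ T.SameAnnotations y (g d')

/-- The closure of the links under the selected role inclusions. -/
def BaseRel (K : ProbKB NC NR NI ι) (T : Tableau NC NR NI ι) (σ : Finset ι) (g : Δ → Node NI)
    (R : Role NR) (d d' : Δ) : Prop :=
  ∃ R₀, K.SubRole σ R₀ R ∧ Link T σ g R₀ d d'

/-- The interpretation of a role in the canonical model: the closure of the links under the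
selected role inclusions and transitivity axioms. -/
def CanonRel (K : ProbKB NC NR NI ι) (T : Tableau NC NR NI ι) (σ : Finset ι) (g : Δ → Node NI)
    (S : Role NR) (d d' : Δ) : Prop :=
  K.BaseRel T σ g S d d' ∨
    ∃ R, K.SubRole σ R S ∧ K.IsTrans σ R ∧ Relation.TransGen (K.BaseRel T σ g R) d d'

section Relations

variable {K : ProbKB NC NR NI ι} {T : Tableau NC NR NI ι} {σ : Finset ι} {g : Δ → Node NI}

theorem Link.inverse {R : Role NR} {d d' : Δ} (h : Link T σ g R d d') :
    Link T σ g R.inverse d' d := by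
  obtain ⟨x, y, h, hx, hy⟩ := h
  exact ⟨y, x, by rwa [Assertion.role_inverse], hy, hx⟩

theorem BaseRel.inverse {R : Role NR} {d d' : Δ} (h : K.BaseRel T σ g R d d') :
    K.BaseRel T σ g R.inverse d' d := by
  obtain ⟨R₀, h₀, h⟩ := h
  exact ⟨_, h₀.inverse, h.inverse⟩

theorem BaseRel.mono {R S : Role NR} (hRS : K.SubRole σ R S) {d d' : Δ}
    (h : K.BaseRel T σ g R d d') : K.BaseRel T σ g S d d' := by
  obtain ⟨R₀, h₀, h⟩ := h
  exact ⟨_, h₀.trans hRS, h⟩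

theorem CanonRel.inverse {R : Role NR} {d d' : Δ} (h : K.CanonRel T σ g R d d') :
    K.CanonRel T σ g R.inverse d' d := by
  obtain h | ⟨R', hR, ht, h⟩ := h
  · exact .inl h.inverse
  · refine .inr ⟨_, hR.inverse, ht.inverse, ?_⟩
    rw [← Relation.transGen_swap] at h
    exact Relation.TransGen.mono (fun _ _ h => BaseRel.inverse h) _ _ h

theorem CanonRel.mono {R S : Role NR} (hRS : K.SubRole σ R S) {d d' : Δ}
    (h : K.CanonRel T σ g R d d') : K.CanonRel T σ g S d d' := by
  obtain h | ⟨R', hR, ht, h⟩ := h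
  · exact .inl (h.mono hRS)
  · exact .inr ⟨_, hR.trans hRS, ht, h⟩

theorem CanonRel.trans {R : Role NR} (hR : K.IsTrans σ R) {d₁ d₂ d₃ : Δ}
    (h : K.CanonRel T σ g R d₁ d₂) (h' : K.CanonRel T σ g R d₂ d₃) :
    K.CanonRel T σ g R d₁ d₃ := by
  have key : ∀ {d d'}, K.CanonRel T σ g R d d' → Relation.TransGen (K.BaseRel T σ g R) d d' := by
    rintro d d' (h | ⟨R', hR', ht, h⟩)
    · exact .single h
    · exact Relation.TransGen.mono (fun _ _ h => BaseRel.mono hR' h) _ _ h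
  exact .inr ⟨R, .refl, hR, (key h).trans (key h')⟩

/-- Value restrictions hold along the relations of the canonical model: the `∀⁺`-rule hands
`∀R.C` on along a path of links for a transitive `R`. -/
theorem CanonRel.holds_of_all (hT : ∀ Ts, ¬ K.Expands T Ts) {S : Role NR} {C : NConcept NC NR}
    {d d' : Δ} (h : K.CanonRel T σ g S d d') (hd : T.Holds σ (.concept (g d) (.all S C))) :
    T.Holds σ (.concept (g d') C) := by
  have step : ∀ {S d d'}, K.BaseRel T σ g S d d' → T.Holds σ (.concept (g d) (.all S C)) →
      T.Holds σ (.concept (g d') C) := by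
    rintro S d d' ⟨R₀, hR₀, x, y, hxy, hx, hy⟩ hd
    obtain ⟨B, hB, h⟩ := holds_of_not_expands hT (σ := σ) (.univ x y R₀ S C σ hR₀)
      (by simpa using ⟨hx.symm.holds hd, hxy⟩) subset_rfl
    simp only [List.mem_singleton] at hB
    subst hB
    exact hy.holds (h _ (by simp))
  have stepPlus : ∀ {R S d d'}, K.BaseRel T σ g R d d' → K.SubRole σ R S → K.IsTrans σ R →
      T.Holds σ (.concept (g d) (.all S C)) → T.Holds σ (.concept (g d') (.all R C)) := by
    rintro R S d d' ⟨R₀, hR₀, x, y, hxy, hx, hy⟩ hRS ⟨i, hi, ht⟩ hd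
    obtain ⟨B, hB, h⟩ := holds_of_not_expands hT (σ := σ) (.univPlus x y R₀ R S C σ i hR₀ hRS ht)
      (by simpa using ⟨hx.symm.holds hd, hxy⟩) (by simp [hi])
    simp only [List.mem_singleton] at hB
    subst hB
    exact hy.holds (h _ (by simp))
  obtain h | ⟨R, hR, ht, h⟩ := h
  · exact step h hd
  · suffices T.Holds σ (.concept (g d') C) ∧ T.Holds σ (.concept (g d') (.all R C)) from this.1
    induction h with
    | single h => exact ⟨step (h.mono hR) hd, stepPlus h hR ht hd⟩
    | tail _ h ih => exact ⟨step h ih.2, stepPlus h .refl ht ih.2⟩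

end Relations

open Classical in
/-- The element that interprets an individual; it is arbitrary for individuals not represented. -/
noncomputable def canonMap [Nonempty Δ] (g : Δ → Node NI) (x : Node NI) : Δ :=
  if h : ∃ d, g d = x then h.choose else Classical.arbitrary Δ

/-- The canonical interpretation. -/
noncomputable def canon [Nonempty Δ] (K : ProbKB NC NR NI ι) (T : Tableau NC NR NI ι)
    (σ : Finset ι) (g : Δ → Node NI) : Interp NC NR NI Δ where
  con A := {d | T.Holds σ (.concept (g d) (.atom (some A)))}
  rol r := K.CanonRel T σ g (.atom r)
  ind a := canonMap g (.named a)

/-- The canonical interpretation of the extra atomic concept. -/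
def canonExtra (T : Tableau NC NR NI ι) (σ : Finset ι) (g : Δ → Node NI) : Set Δ :=
  {d | T.Holds σ (.concept (g d) (.atom none))}

section Canon

variable [Nonempty Δ] {K : ProbKB NC NR NI ι} {T : Tableau NC NR NI ι} {σ : Finset ι}
  {g : Δ → Node NI}

theorem canon_role (R : Role NR) (d d' : Δ) :
    (K.canon T σ g).role R d d' ↔ K.CanonRel T σ g R d d' := by
  cases R with
  | atom r => rfl
  | inv r => exact ⟨fun h => CanonRel.inverse h, fun h => CanonRel.inverse h⟩

omit [LinearOrder ι] in
theorem Represents.canonMap (hg : Represents T g) {x : Node NI} (hx : x ∈ T.nodes)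
    (hb : ¬ T.Blocked x) : g (canonMap g x) = x := by
  have h := hg.surj x hx hb
  rw [ProbKB.canonMap, dif_pos h]
  exact h.choose_spec

/-- Truth lemma: every concept assertion of the tableau under `σ` holds in the canonical model. -/
theorem Represents.mem_nconcept (hg : Represents T g) (hT : ∀ Ts, ¬ K.Expands T Ts)
    (htree : T.TreeShaped) (hσ : ¬ T.clashBDD.eval σ = true) {C : NConcept NC NR} {d : Δ}
    (hd : T.Holds σ (.concept (g d) C)) :
    d ∈ (K.canon T σ g).nconcept (canonExtra T σ g) C := by
  rw [Tableau.eval_clashBDD, not_or] at hσ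
  induction C generalizing d with
  | top => trivial
  | bot => exact (hσ.1 ⟨_, hd⟩).elim
  | atom A => cases A <;> exact hd
  | natom A =>
    intro h
    refine hσ.2 ⟨g d, A, ?_, hd⟩
    cases A <;> exact h
  | inter C D ih₁ ih₂ =>
    obtain ⟨B, hB, h⟩ := holds_of_not_expands hT (σ := σ) (.inter (g d) C D)
      (by simpa using hd) (by simp)
    simp only [List.mem_singleton] at hB
    subst hB
    exact ⟨ih₁ (h _ (by simp)), ih₂ (h _ (by simp))⟩
  | union C D ih₁ ih₂ =>
    obtain ⟨B, hB, h⟩ := holds_of_not_expands hT (σ := σ) (.union (g d) C D)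
      (by simpa using hd) (by simp)
    simp only [List.mem_cons, List.not_mem_nil, or_false] at hB
    rcases hB with rfl | rfl
    · exact .inl (ih₁ (h _ (by simp)))
    · exact .inr (ih₂ (h _ (by simp)))
  | ex S C ih =>
    obtain ⟨z, R, hR, hz, hC⟩ := exists_witness_of_not_expands hT hd (hg.not_blocked d)
    obtain ⟨y, hy, hs⟩ := htree.exists_not_blocked (hg.not_blocked d) hz.1
    obtain ⟨d', rfl⟩ := hg.surj y ((hs.holds hC).mem_nodes (by simp)) hy
    exact ⟨d', (canon_role _ _ _).2 (.inl ⟨R, hR, _, _, hz, .refl _ _, hs⟩), ih (hs.holds hC)⟩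
  | all S C ih =>
    intro d' hd'
    exact ih (((canon_role _ _ _).1 hd').holds_of_all hT hd)

theorem Represents.models (hg : Represents T g) (hT : ∀ Ts, ¬ K.Expands T Ts)
    (htree : T.TreeShaped) (hσ : ¬ T.clashBDD.eval σ = true) {a : Assertion NC NR NI}
    (ha : T.Holds σ a) (hroot : ∀ x ∈ a.nodes, x.IsRoot) :
    (K.canon T σ g).Models (canonExtra T σ g) (ProbKB.canonMap g) a := by
  have key : ∀ x ∈ a.nodes, g (ProbKB.canonMap g x) = x := fun x hx =>
    hg.canonMap (ha.mem_nodes hx) (Tableau.not_blocked_of_isRoot (hroot x hx))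
  cases a with
  | concept x C =>
    refine hg.mem_nconcept hT htree hσ ?_
    rwa [key x (by simp)]
  | edge x y r =>
    refine .inl ⟨.atom r, .refl, x, y, ha, ?_, ?_⟩ <;>
    · rw [key _ (by simp [Assertion.nodes])]
      exact .refl _ _

theorem Represents.satisfies (hg : Represents T g) (hT : ∀ Ts, ¬ K.Expands T Ts)
    (htree : T.TreeShaped) (hσ : ¬ T.clashBDD.eval σ = true)
    (hK : ∀ i ∈ σ, ∀ a ∈ (K.ax i).assertion, T.Holds σ a) {i : ι} (hi : i ∈ σ) :
    (K.canon T σ g).Satisfies (K.ax i) := by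
  have hass : ∀ a ∈ (K.ax i).assertion,
      (K.canon T σ g).Models (canonExtra T σ g) (ProbKB.canonMap g) a := fun a ha =>
    hg.models hT htree hσ (hK i hi a ha) fun x hx => isRoot_of_mem_assertion ha hx
  cases h : K.ax i with
  | trans R =>
    intro x y z hxy hyz
    rw [canon_role] at *
    exact hxy.trans ⟨i, hi, .inl h⟩ hyz
  | roleIncl R S =>
    intro x y hxy
    rw [canon_role] at *
    exact hxy.mono (.single ⟨i, hi, .inl h⟩)
  | conceptIncl C D =>
    intro d hd
    by_cases hC : C.IsAtomic
    · cases C <;> try exact hC.elim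
      rename_i A
      obtain ⟨B, hB, h⟩ := holds_of_not_expands hT (σ := σ) (.unfold (g d) A D i h)
        (by simpa using! hd) (by simpa using hi)
      simp only [List.mem_singleton] at hB
      subst hB
      simpa using hg.mem_nconcept hT htree hσ (h (.concept (g d) (D.nnf true)) (by simp))
    · obtain ⟨B, hB, h⟩ := holds_of_not_expands hT (σ := σ) (.ce C D i hC h)
        (by simp) (by simpa using hi)
      simp only [List.mem_singleton] at hB
      subst hB
      have := hg.mem_nconcept hT htree hσ 
        (h (.concept (g d) (.union (C.nnf false) (D.nnf true)))
          (by
          simp only [Finset.mem_image]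
          exact ⟨g d, hg.mem d, rfl⟩))
      simp only [Interp.nconcept, Interp.nconcept_nnf_true, Interp.nconcept_nnf_false] at this
      exact this.resolve_left fun h => h hd
  | conceptMem a C =>
    simpa [h, KBAxiom.assertion] using! hass
  | roleMem a b r =>
    simpa [h, KBAxiom.assertion] using! hass

end Canon

/-! ### Completeness -/

omit [LinearOrder ι] in
/-- As a tableau is finite, its unblocked individuals can be represented in any universe. -/
theorem exists_represents (T : Tableau NC NR NI ι) {x : Node NI} (hx : x ∈ T.nodes)
    (hb : ¬ T.Blocked x) : ∃ (Δ : Type v) (_ : Nonempty Δ) (g : Δ → Node NI), Represents T g := by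
  classical
  let V := T.nodes.filter fun x => ¬ T.Blocked x
  have hV : ∀ x, x ∈ V ↔ x ∈ T.nodes ∧ ¬ T.Blocked x := fun x => by simp [V]
  refine ⟨ULift (Fin V.card), ⟨⟨V.equivFin ⟨x, (hV x).2 ⟨hx, hb⟩⟩⟩⟩,
    fun d => V.equivFin.symm d.down, ⟨fun d => ?_, fun d => ?_, fun y hy hyb => ?_⟩⟩
  · exact ((hV _).1 (V.equivFin.symm d.down).2).1
  · exact ((hV _).1 (V.equivFin.symm d.down).2).2
  · exact ⟨⟨V.equivFin ⟨y, (hV y).2 ⟨hy, hyb⟩⟩⟩, by simp⟩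

theorem exists_isRoot_of_negQuery (Q : KBAxiom NC NR NI) :
    ∃ a ∈ negQuery Q, ∃ x ∈ a.nodes, x.IsRoot := by
  suffices ∃ a ∈ negQuery Q, ∃ x, x ∈ a.nodes by
    obtain ⟨a, ha, x, hx⟩ := this
    exact ⟨a, ha, x, hx, isRoot_of_mem_negQuery ha hx⟩
  cases Q <;> simp [negQuery]

/-- Completeness: if the axioms selected by `σ` entail the query, the final BDD of a fully expanded
forest is true under `σ`. -/
theorem eval_finalBDD_of_entails [Fintype ι] {K : ProbKB NC NR NI ι} {Q : KBAxiom NC NR NI}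
    {F : List (Tableau NC NR NI ι)} (h : Relation.ReflTransGen K.Step [K.initial Q] F)
    (hF : K.FullyExpanded F) {σ : Finset ι} (hσ : Entails.{v} (K.selected σ) Q) :
    (finalBDD F).eval σ = true := by
  rw [eval_finalBDD]
  intro T hT
  by_contra hclash
  have htree : T.TreeShaped := forall_mem_of_reach
    (fun _ _ hT h => h.treeShaped hT) h (by simpa using K.treeShaped_initial Q) T hT
  have hinit : ∀ a, (K.initial Q).Holds σ a → T.Holds σ a := by
    refine forall_mem_of_reach (P := fun T => ∀ a, (K.initial Q).Holds σ a → T.Holds σ a)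
      (fun T₁ Ts hT₁ h T₂ hT₂ a ha => ?_) h (by simp) T hT
    obtain ⟨ψ, B, rfl⟩ := h.exists_insertion T₂ hT₂
    exact Tableau.holds_insertion.2 (.inl (hT₁ a ha))
  simp only [holds_initial] at hinit
  obtain ⟨a, ha, x, hx, hroot⟩ := exists_isRoot_of_negQuery Q
  obtain ⟨Δ, _, g, hg⟩ := exists_represents.{v} T ((hinit a (.inl ha)).mem_nodes hx)
    (Tableau.not_blocked_of_isRoot hroot)
  refine ((K.canon T σ g).exists_models_negQuery_iff Q).1
    ⟨canonExtra T σ g, canonMap g, fun _ => rfl, fun a ha => ?_⟩ (hσ Δ _ ?_)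
  · exact hg.models (hF T hT) htree hclash (hinit a (.inl ha))
      fun x hx => isRoot_of_mem_negQuery ha hx
  · rintro _ ⟨i, hi, rfl⟩
    exact hg.satisfies (hF T hT) htree hclash (fun i hi a ha => hinit a (.inr ⟨i, hi, ha⟩)) hi

end ProbKB

/-! ### A finite set of concepts that contains all concepts of a run -/

/-- Closure under the concepts that the rules `⊓`, `⊔`, `∃` and `∀` produce. -/
structure SubClosed {NC NR : Type*} (s : Set (NConcept NC NR)) : Prop where
  inter : ∀ C D, .inter C D ∈ s → C ∈ s ∧ D ∈ s
  union : ∀ C D, .union C D ∈ s → C ∈ s ∧ D ∈ s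
  ex : ∀ S C, .ex S C ∈ s → C ∈ s
  all : ∀ S C, .all S C ∈ s → C ∈ s

/-- Closure under the concepts that the rules produce, the axioms of `K` included. -/
structure RuleClosed {NC NR NI ι : Type*} (K : ProbKB NC NR NI ι)
    (s : Set (NConcept NC NR)) : Prop extends SubClosed s where
  unfold : ∀ i A D, K.ax i = .conceptIncl (.atom A) D → D.nnf true ∈ s
  ce : ∀ i C D, K.ax i = .conceptIncl C D → .union (C.nnf false) (D.nnf true) ∈ s
  univPlus : ∀ i R S C, K.ax i = .trans R ∨ K.ax i = .trans R.inverse → .all S C ∈ s →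
    .all R C ∈ s

section Closure

variable {NC NR NI ι : Type*}

theorem SubClosed.iUnion {κ : Sort*} {s : κ → Set (NConcept NC NR)}
    (h : ∀ j, SubClosed (s j)) : SubClosed (⋃ j, s j) where
  inter C D hC := by
    obtain ⟨j, hj⟩ := Set.mem_iUnion.1 hC
    exact ⟨Set.mem_iUnion.2 ⟨j, ((h j).inter C D hj).1⟩,
      Set.mem_iUnion.2 ⟨j, ((h j).inter C D hj).2⟩⟩
  union C D hC := by
    obtain ⟨j, hj⟩ := Set.mem_iUnion.1 hC
    exact ⟨Set.mem_iUnion.2 ⟨j, ((h j).union C D hj).1⟩,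
      Set.mem_iUnion.2 ⟨j, ((h j).union C D hj).2⟩⟩
  ex S C hC := by
    obtain ⟨j, hj⟩ := Set.mem_iUnion.1 hC
    exact Set.mem_iUnion.2 ⟨j, (h j).ex S C hj⟩
  all S C hC := by
    obtain ⟨j, hj⟩ := Set.mem_iUnion.1 hC
    exact Set.mem_iUnion.2 ⟨j, (h j).all S C hj⟩

theorem exists_finite_subClosed (C : NConcept NC NR) :
    ∃ s : Set (NConcept NC NR), s.Finite ∧ SubClosed s ∧ C ∈ s := by
  induction C with
  | top => exact ⟨{.top}, by simp, ⟨by simp, by simp, by simp, by simp⟩, rfl⟩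
  | bot => exact ⟨{.bot}, by simp, ⟨by simp, by simp, by simp, by simp⟩, rfl⟩
  | atom A => exact ⟨{.atom A}, by simp, ⟨by simp, by simp, by simp, by simp⟩, rfl⟩
  | natom A => exact ⟨{.natom A}, by simp, ⟨by simp, by simp, by simp, by simp⟩, rfl⟩
  | inter C D ih₁ ih₂ =>
    obtain ⟨s, hs, h, hC⟩ := ih₁
    obtain ⟨t, ht, h', hD⟩ := ih₂
    refine ⟨insert (.inter C D) (s ∪ t), (hs.union ht).insert _, ?_, by simp⟩
    constructor <;> simp only [Set.mem_insert_iff, Set.mem_union] <;>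
      grind [SubClosed.inter, SubClosed.union, SubClosed.ex, SubClosed.all]
  | union C D ih₁ ih₂ =>
    obtain ⟨s, hs, h, hC⟩ := ih₁
    obtain ⟨t, ht, h', hD⟩ := ih₂
    refine ⟨insert (.union C D) (s ∪ t), (hs.union ht).insert _, ?_, by simp⟩
    constructor <;> simp only [Set.mem_insert_iff, Set.mem_union] <;>
      grind [SubClosed.inter, SubClosed.union, SubClosed.ex, SubClosed.all]
  | ex S C ih =>
    obtain ⟨s, hs, h, hC⟩ := ih
    refine ⟨insert (.ex S C) s, hs.insert _, ?_, by simp⟩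
    constructor <;> simp only [Set.mem_insert_iff] <;>
      grind [SubClosed.inter, SubClosed.union, SubClosed.ex, SubClosed.all]
  | all S C ih =>
    obtain ⟨s, hs, h, hC⟩ := ih
    refine ⟨insert (.all S C) s, hs.insert _, ?_, by simp⟩
    constructor <;> simp only [Set.mem_insert_iff] <;>
      grind [SubClosed.inter, SubClosed.union, SubClosed.ex, SubClosed.all]

/-- The concepts that the unfold and CE rules add for an axiom. -/
def KBAxiom.generated : KBAxiom NC NR NI → Set (NConcept NC NR)
  | .conceptIncl C D => {D.nnf true, .union (C.nnf false) (D.nnf true)}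
  | _ => ∅

/-- Finitely many concepts lie in a finite set that is closed under all rules: the `∀⁺`-rule only
adds to the subconcepts the concepts `∀R.C` with `R` transitive and `∀S.C` a subconcept. -/
theorem exists_finite_ruleClosed [Finite ι] (K : ProbKB NC NR NI ι) {G : Set (NConcept NC NR)}
    (hG : G.Finite) : ∃ s : Set (NConcept NC NR), s.Finite ∧ RuleClosed K s ∧ G ⊆ s := by
  choose sub hfin hclosed hmem using exists_finite_subClosed (NC := NC) (NR := NR)
  let G' : Set (NConcept NC NR) := G ∪ ⋃ i, (K.ax i).generated
  have hG' : G'.Finite := by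
    refine hG.union (Set.finite_iUnion fun i => ?_)
    cases K.ax i <;> simp [KBAxiom.generated]
  let s₀ : Set (NConcept NC NR) := ⋃ C : G', sub C
  have hs₀ : s₀.Finite := by
    have := hG'.to_subtype
    exact Set.finite_iUnion fun C => hfin C
  have hG's₀ : G' ⊆ s₀ := fun C hC => Set.mem_iUnion.2 ⟨⟨C, hC⟩, hmem C⟩
  have hc : SubClosed s₀ := .iUnion fun C => hclosed C
  let tr : Set (Role NR) := ⋃ i, {R | K.ax i = .trans R ∨ K.ax i = .trans R.inverse}
  have htr : tr.Finite := by
    refine Set.finite_iUnion fun i => ?_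
    cases h : K.ax i with
    | trans R =>
      refine (Set.toFinite {R, R.inverse}).subset ?_
      rintro S (h | h)
      · cases h; simp
      · cases h; simp [Role.inverse_inverse]
    | _ => exact Set.finite_empty.subset fun R h => by simp at h
  let s₁ : Set (NConcept NC NR) := {D | ∃ R ∈ tr, ∃ S C, .all S C ∈ s₀ ∧ D = .all R C}
  have hs₁ : s₁.Finite := by
    refine (Set.Finite.image2 NConcept.all htr hs₀).subset ?_
    rintro _ ⟨R, hR, S, C, hC, rfl⟩
    exact ⟨R, hR, C, hc.all _ _ hC, rfl⟩
  refine ⟨s₀ ∪ s₁, hs₀.union hs₁, ⟨⟨?_, ?_, ?_, ?_⟩, ?_, ?_, ?_⟩, fun C hC =>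
    .inl (hG's₀ (.inl hC))⟩
  · rintro C D (h | ⟨_, _, _, _, _, h⟩)
    · exact ⟨.inl (hc.inter _ _ h).1, .inl (hc.inter _ _ h).2⟩
    · cases h
  · rintro C D (h | ⟨_, _, _, _, _, h⟩)
    · exact ⟨.inl (hc.union _ _ h).1, .inl (hc.union _ _ h).2⟩
    · cases h
  · rintro S C (h | ⟨_, _, _, _, _, h⟩)
    · exact .inl (hc.ex _ _ h)
    · cases h
  · rintro S C (h | ⟨_, _, _, _, h', h⟩)
    · exact .inl (hc.all _ _ h)
    · cases h
      exact .inl (hc.all _ _ h')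
  · intro i A D h
    exact .inl (hG's₀ (.inr (Set.mem_iUnion.2 ⟨i, by simp [h, KBAxiom.generated]⟩)))
  · intro i C D h
    exact .inl (hG's₀ (.inr (Set.mem_iUnion.2 ⟨i, by simp [h, KBAxiom.generated]⟩)))
  · rintro i R S C hi (h | ⟨_, _, _, _, h', h⟩)
    · exact .inr ⟨R, Set.mem_iUnion.2 ⟨i, hi⟩, _, _, h, rfl⟩
    · cases h
      exact .inr ⟨R, Set.mem_iUnion.2 ⟨i, hi⟩, _, _, h', rfl⟩

end Closure

namespace ProbKB

/-- The rules that generate no individual add only concepts of a closed set. -/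
theorem RuleInst.mem_of_ruleClosed {NC NR NI ι : Type*} {K : ProbKB NC NR NI ι}
    {s : Set (NConcept NC NR)} (hs : RuleClosed K s) {T : Tableau NC NR NI ι}
    (hT : ∀ x C, .concept x C ∈ T.assertions → C ∈ s) {B₀ : Finset (Assertion NC NR NI)}
    {E : Finset ι} {Bs : List (Finset (Assertion NC NR NI))} (h : K.RuleInst T B₀ E Bs)
    (hB₀ : B₀ ⊆ T.assertions) {B : Finset (Assertion NC NR NI)} (hB : B ∈ Bs)
    {x : Node NI} {C : NConcept NC NR} (ha : .concept x C ∈ B) : C ∈ s := by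
  have hB₀' : ∀ y D, .concept y D ∈ B₀ → D ∈ s := fun y D h => hT y D (hB₀ h)
  cases h with
  | unfold x A D i hi =>
    simp only [List.mem_singleton] at hB; subst hB
    simp only [Finset.mem_singleton, Assertion.concept.injEq] at ha
    rw [ha.2]
    exact hs.unfold _ _ _ hi
  | ce C D i hC hi =>
    simp only [List.mem_singleton] at hB; subst hB
    simp only [Finset.mem_image, Assertion.concept.injEq] at ha
    obtain ⟨_, -, -, rfl⟩ := ha
    exact hs.ce _ _ _ hi
  | inter x C D =>
    simp only [List.mem_singleton] at hB; subst hB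
    simp only [Finset.mem_insert, Finset.mem_singleton, Assertion.concept.injEq] at ha
    have := hs.inter _ _ (hB₀' x (.inter C D) (by simp))
    rcases ha with ⟨-, rfl⟩ | ⟨-, rfl⟩
    · exact this.1
    · exact this.2
  | union x C D =>
    have := hs.union _ _ (hB₀' x (.union C D) (by simp))
    simp only [List.mem_cons, List.not_mem_nil, or_false] at hB
    rcases hB with rfl | rfl <;>
      simp only [Finset.mem_singleton, Assertion.concept.injEq] at ha <;> rw [ha.2]
    · exact this.1
    · exact this.2
  | univ x y R₀ S C E hS =>
    simp only [List.mem_singleton] at hB; subst hB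
    simp only [Finset.mem_singleton, Assertion.concept.injEq] at ha
    rw [ha.2]
    exact hs.all _ _ (hB₀' x (.all S C) (by simp))
  | univPlus x y R₀ R S C E i hR hS hi =>
    simp only [List.mem_singleton] at hB; subst hB
    simp only [Finset.mem_singleton, Assertion.concept.injEq] at ha
    rw [ha.2]
    exact hs.univPlus _ _ _ _ hi (hB₀' x (.all S C) (by simp))

end ProbKB

/-! ### The size of the tableaux of a run -/

namespace Node

variable {NI : Type*}

/-- The number of predecessors of an individual. -/
def depth : Node NI → ℕ
  | .anon x _ => depth x + 1
  | _ => 0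

/-- The parent of a generated individual; roots are their own parents. -/
def parent : Node NI → Node NI
  | .anon x _ => x
  | x => x

/-- An individual, followed by its predecessors. -/
def path : Node NI → List (Node NI)
  | .named a => [.named a]
  | .query k => [.query k]
  | .anon x k => .anon x k :: path x

theorem length_path (x : Node NI) : x.path.length = x.depth + 1 := by
  induction x <;> simp_all [path, depth]

theorem mem_path_iff {x y : Node NI} : y ∈ x.path ↔ y = x ∨ Ancestor y x := by
  induction x <;> simp_all [path, Ancestor]

theorem depth_eq_zero_iff {x : Node NI} : x.depth = 0 ↔ x.IsRoot := by
  cases x <;> simp [depth, IsRoot]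

/-- A forest of bounded depth has boundedly many nodes if a tag from a finite type distinguishes the
children of each node. -/
theorem card_le_of_tag {τ : Type*} [Fintype τ] (V roots : Finset (Node NI)) (tag : Node NI → τ)
    (hroot : ∀ x ∈ V, x.IsRoot → x ∈ roots) (hparent : ∀ x k, .anon x k ∈ V → x ∈ V)
    (htag : ∀ x k k', .anon x k ∈ V → .anon x k' ∈ V → tag (.anon x k) = tag (.anon x k') →
      k = k') (n : ℕ) (hdepth : ∀ x ∈ V, x.depth ≤ n) :
    V.card ≤ roots.card * (Fintype.card τ + 1) ^ n := by
  classical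
  suffices ∀ m, (V.filter fun x => x.depth ≤ m).card ≤
      roots.card * (Fintype.card τ + 1) ^ m by
    simpa [Finset.filter_true_of_mem hdepth] using this n
  intro m
  induction m with
  | zero =>
    rw [pow_zero, mul_one]
    refine Finset.card_le_card fun x hx => ?_
    simp only [Finset.mem_filter, Nat.le_zero, depth_eq_zero_iff] at hx
    exact hroot x hx.1 hx.2
  | succ m ih =>
    have hcard : ((V.filter fun x => x.depth ≤ m) ×ˢ (Finset.univ : Finset (Option τ))).card ≤
        roots.card * (Fintype.card τ + 1) ^ (m + 1) := by
      rw [Finset.card_product, Finset.card_univ, Fintype.card_option, pow_succ, ← mul_assoc]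
      exact Nat.mul_le_mul_right _ ih
    refine le_trans ?_ hcard
    -- A node of depth `m + 1` is determined by its parent and its tag.
    refine Finset.card_le_card_of_injOn
      (fun x => if x.depth ≤ m then (x, none) else (x.parent, some (tag x))) ?_ ?_
    · intro x hx
      simp only [Finset.coe_filter, Set.mem_ofPred_eq] at hx
      by_cases hm : x.depth ≤ m
      · simp [hm, hx.1]
      · cases x with
        | anon x k =>
          simp only [depth] at hx hm
          simp only [depth, hm, if_false, parent, Finset.coe_product, Set.mem_prod,
            Finset.mem_coe, Finset.mem_filter, Finset.mem_univ, and_true]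
          exact ⟨hparent x k hx.1, by omega⟩
        | _ => simp [depth] at hm
    · intro x hx y hy hxy
      simp only [Finset.coe_filter, Set.mem_ofPred_eq] at hx hy
      by_cases hm : x.depth ≤ m <;> by_cases hm' : y.depth ≤ m <;>
        simp only [hm, hm', if_true, if_false, Prod.mk.injEq, reduceCtorEq, and_false, and_true,
          Option.some.injEq] at hxy
      · exact hxy
      · cases x <;> cases y <;> simp only [depth, Nat.zero_le, not_true] at hm hm'
        simp only [parent] at hxy
        obtain ⟨rfl, h⟩ := hxy
        rw [htag _ _ _ hx.1 hy.1 h]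

end Node

namespace Tableau

variable {NC NR NI ι : Type*} [LinearOrder ι]

/-- The labels of the assertions are reduced ordered diagrams. -/
def LabelsReduced (T : Tableau NC NR NI ι) : Prop :=
  ∀ a ∈ T.assertions, (T.lab a).IsReduced

theorem LabelsReduced.insertion {T : Tableau NC NR NI ι} (hT : T.LabelsReduced) {ψ : BDD ι}
    (hψ : ψ.IsReduced) (B : Finset (Assertion NC NR NI)) : (T.insertion ψ B).LabelsReduced := by
  intro a ha
  rw [mem_insertion] at ha
  simp only [Tableau.insertion]
  split_ifs with h₁ h₂
  · exact (hT a h₂).or hψ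
  · exact hψ
  · refine hT a (ha.elim id fun h => ?_)
    by_contra h'
    exact h₁ (mem_ins.2 ⟨h, .inl h'⟩)

theorem LabelsReduced.psi {T : Tableau NC NR NI ι} (hT : T.LabelsReduced)
    {B₀ : Finset (Assertion NC NR NI)} (hB₀ : B₀ ⊆ T.assertions) (E : Finset ι) :
    (ProbKB.psi T B₀ E).IsReduced := by
  refine .and (.conj fun A hA => ?_) (.conj fun A hA => ?_)
  · obtain ⟨a, ha, rfl⟩ := List.mem_map.1 hA
    exact hT a (hB₀ (Finset.mem_toList.1 ha))
  · obtain ⟨i, -, rfl⟩ := List.mem_map.1 hA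
    exact BDD.isReduced_var i

theorem LabelsReduced.clashBDD {T : Tableau NC NR NI ι} (hT : T.LabelsReduced) :
    T.clashBDD.IsReduced := by
  refine .disj fun A hA => ?_
  obtain ⟨a, ha, rfl⟩ := List.mem_map.1 hA
  have ha := hT a (Finset.mem_toList.1 ha)
  unfold clashLabel
  split
  · exact ha
  · split_ifs with h
    · exact ha.and (hT _ h)
    · trivial
  · trivial

theorem LabelsReduced.insertable_iff {T : Tableau NC NR NI ι} (hT : T.LabelsReduced) {ψ : BDD ι}
    (hψ : ψ.IsReduced) {a : Assertion NC NR NI} :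
    T.Insertable ψ a ↔ a ∉ T.assertions ∨ ∃ σ, ψ.eval σ = true ∧ ¬ T.Holds σ a := by
  by_cases ha : a ∈ T.assertions
  · simp [Insertable, ha, Holds, (hT a ha).or_eq_left_iff hψ]
  · simp [Insertable, ha]

open Classical in
/-- The annotations of an individual with concepts of `s`. -/
noncomputable def annotations (T : Tableau NC NR NI ι) (s : Finset (NConcept NC NR)) (x : Node NI) :
    s → Option (Finset ι → Bool) :=
  fun C => if .concept x C.1 ∈ T.assertions then some (T.lab (.concept x C.1)).eval else none

theorem sameAnnotations_of_annotations_eq {T : Tableau NC NR NI ι} (hT : T.LabelsReduced)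
    {s : Finset (NConcept NC NR)} (hs : ∀ x C, .concept x C ∈ T.assertions → C ∈ s)
    {x y : Node NI} (h : T.annotations s x = T.annotations s y) : T.SameAnnotations x y := by
  intro C
  by_cases hC : C ∈ s
  · have := congrFun h ⟨C, hC⟩
    unfold annotations at this
    split_ifs at this with h₁ h₂ h₂
    · refine ⟨by simp only [h₁, h₂], fun _ => ?_⟩
      exact (hT _ h₁).eq_of_eval_eq (hT _ h₂) (congrFun (Option.some.inj this))
    · simp [h₁, h₂]
  · have h₁ : .concept x C ∉ T.assertions := fun h => hC (hs x C h)
    have h₂ : .concept y C ∉ T.assertions := fun h => hC (hs y C h)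
    simp [h₁, h₂]

/-- Blocking bounds the depth: an unblocked individual and its predecessors have pairwise different
annotations. -/
theorem depth_lt_of_not_blocked [Fintype ι] {T : Tableau NC NR NI ι} (hT : T.LabelsReduced)
    {s : Finset (NConcept NC NR)} (hs : ∀ x C, .concept x C ∈ T.assertions → C ∈ s)
    {x : Node NI} (hx : ¬ T.Blocked x) :
    x.depth < Nat.card (s → Option (Finset ι → Bool)) := by
  classical
  suffices (x.path.map (T.annotations s)).Nodup by
    have := this.length_le_card
    rw [← Nat.card_eq_fintype_card, List.length_map, Node.length_path] at this
    exact this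
  induction x with
  | named a => simp [Node.path]
  | query k => simp [Node.path]
  | anon x k ih =>
    simp only [Blocked, not_or, not_exists, not_and] at hx
    rw [Node.path, List.map_cons, List.nodup_cons]
    refine ⟨fun h => ?_, ih hx.2⟩
    obtain ⟨y, hy, h⟩ := List.mem_map.1 h
    refine hx.1 y ?_ (sameAnnotations_of_annotations_eq hT hs h)
    exact Node.mem_path_iff.1 hy

end Tableau

/-! ### Termination -/

namespace ProbKB

variable {NC NR NI ι : Type*} [LinearOrder ι]

/-- The application of the `∃`-rule recorded by `t = (∃S.C, ψ)`, with `ψ` as a Boolean function,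
has left its traces at the child `z` of `x`. -/
def Recorded {s : Finset (NConcept NC NR)} (T : Tableau NC NR NI ι) (x z : Node NI)
    (t : Option (s × (Finset ι → Bool))) : Prop :=
  ∀ D f, t = some (D, f) → ∀ S C, D.1 = .ex S C →
    (.role x z S ∈ T.assertions ∧ .concept z C ∈ T.assertions) ∧
      ∀ σ, f σ = true → T.Holds σ (.role x z S) ∧ T.Holds σ (.concept z C)

/-- The invariant behind termination: concepts come from `s`, roots from `roots`, the depth is
at most `n`, and the children of each individual were generated by `∃`-rule applications with
different pairs of a concept and a label, which serve as tags. -/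
structure Bounded (s : Finset (NConcept NC NR)) (roots : Finset (Node NI)) (n : ℕ)
    (T : Tableau NC NR NI ι) : Prop where
  reduced : T.LabelsReduced
  mem : ∀ x C, .concept x C ∈ T.assertions → C ∈ s
  root : ∀ x ∈ T.nodes, x.IsRoot → x ∈ roots
  parent : ∀ x k, .anon x k ∈ T.nodes → x ∈ T.nodes
  depth : ∀ x ∈ T.nodes, x.depth ≤ n
  tag : ∃ tag : Node NI → Option (s × (Finset ι → Bool)),
    (∀ x k, .anon x k ∈ T.nodes → Recorded T x (.anon x k) (tag (.anon x k))) ∧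
    ∀ x k k', .anon x k ∈ T.nodes → .anon x k' ∈ T.nodes →
      tag (.anon x k) = tag (.anon x k') → k = k'

theorem Recorded.insertion {s : Finset (NConcept NC NR)} {T : Tableau NC NR NI ι} {x z : Node NI}
    {t : Option (s × (Finset ι → Bool))} (h : Recorded T x z t) (ψ : BDD ι)
    (B : Finset (Assertion NC NR NI)) : Recorded (T.insertion ψ B) x z t := by
  intro D f ht S C hD
  obtain ⟨⟨h₁, h₂⟩, h₃⟩ := h D f ht S C hD
  simp only [Tableau.mem_insertion, Tableau.holds_insertion]
  exact ⟨⟨.inl h₁, .inl h₂⟩, fun σ hσ => ⟨.inl (h₃ σ hσ).1, .inl (h₃ σ hσ).2⟩⟩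

open Classical in
/-- A measure of the progress of a tableau: its concept assertions, each together with the
valuations that make its label true. -/
noncomputable def records [Fintype ι] (s : Finset (NConcept NC NR)) (T : Tableau NC NR NI ι) :
    Finset (Node NI × NConcept NC NR × Option (Finset ι)) :=
  (T.nodes ×ˢ s ×ˢ Finset.univ).filter fun r =>
    .concept r.1 r.2.1 ∈ T.assertions ∧ ∀ σ, r.2.2 = some σ → T.Holds σ (.concept r.1 r.2.1)

/-- The bound on the number of `records`. -/
noncomputable def recordBound (ι : Type*) (s : Finset (NConcept NC NR)) (roots : Finset (Node NI))
    (n : ℕ) : ℕ :=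
  roots.card * (Nat.card (Option (s × (Finset ι → Bool))) + 1) ^ n *
    (s.card * Nat.card (Option (Finset ι)))

theorem Bounded.card_records_le [Fintype ι] {s : Finset (NConcept NC NR)}
    {roots : Finset (Node NI)} {n : ℕ} {T : Tableau NC NR NI ι} (hT : Bounded s roots n T) :
    (records s T).card ≤ recordBound ι s roots n := by
  classical
  rw [records]
  refine (Finset.card_filter_le _ _).trans ?_
  rw [Finset.card_product, Finset.card_product, recordBound, Finset.card_univ,
    Nat.card_eq_fintype_card, Nat.card_eq_fintype_card]
  refine Nat.mul_le_mul_right _ ?_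
  obtain ⟨tag, -, htag⟩ := hT.tag
  exact Node.card_le_of_tag _ _ tag hT.root hT.parent htag n hT.depth

/-- Inserting a `ψ`-insertable concept assertion is progress: either the assertion is new, or, by the
canonicity of reduced ordered diagrams, its label becomes true under a further valuation. -/
theorem card_records_insertion_lt [Fintype ι] {s : Finset (NConcept NC NR)}
    {T : Tableau NC NR NI ι} (hT : T.LabelsReduced) {ψ : BDD ι} (hψ : ψ.IsReduced)
    {B : Finset (Assertion NC NR NI)} {x : Node NI} {C : NConcept NC NR} (hC : C ∈ s)
    (h : .concept x C ∈ T.ins ψ B) :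
    (records s T).card < (records s (T.insertion ψ B)).card := by
  have hmono : ∀ y ∈ T.nodes, y ∈ (T.insertion ψ B).nodes := by
    intro y hy
    obtain ⟨a, ha, hy⟩ := Tableau.mem_nodes.1 hy
    exact Tableau.mem_nodes.2 ⟨a, Tableau.mem_insertion.2 (.inl ha), hy⟩
  rw [Tableau.mem_ins, hT.insertable_iff hψ] at h
  have hx : x ∈ (T.insertion ψ B).nodes :=
    Tableau.mem_nodes.2 ⟨_, Tableau.mem_insertion.2 (.inr h.1), by simp⟩
  refine Finset.card_lt_card ((Finset.ssubset_iff_of_subset fun r hr => ?_).2 ?_)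
  · simp only [records, Finset.mem_filter, Finset.mem_product, Finset.mem_univ, and_true,
      Tableau.mem_insertion, Tableau.holds_insertion] at hr ⊢
    exact ⟨⟨hmono _ hr.1.1, hr.1.2⟩, .inl hr.2.1, fun σ hσ => .inl (hr.2.2 σ hσ)⟩
  · simp only [records, Finset.mem_filter, Finset.mem_product, Finset.mem_univ, and_true,
      Tableau.mem_insertion, Tableau.holds_insertion]
    rcases h with ⟨hB, h | ⟨σ, hσ, h⟩⟩
    · exact ⟨(x, C, none), by simp [hx, hC, hB, h]⟩
    · exact ⟨(x, C, some σ), by simp [hx, hC, hB, hσ, h]⟩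

theorem Expands.length_le {K : ProbKB NC NR NI ι} {T : Tableau NC NR NI ι}
    {Ts : List (Tableau NC NR NI ι)} (h : K.Expands T Ts) : Ts.length ≤ 2 := by
  cases h with
  | rule B₀ E Bs hrule hB₀ happ => cases hrule <;> simp
  | ex x S C k hx hblock happ hfresh => simp

/-- Rules that generate no individual preserve the invariant. -/
theorem Bounded.insertion {s : Finset (NConcept NC NR)} {roots : Finset (Node NI)} {n : ℕ}
    {T : Tableau NC NR NI ι} (hT : Bounded s roots n T) {ψ : BDD ι} (hψ : ψ.IsReduced)
    {B : Finset (Assertion NC NR NI)}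
    (hB : ∀ a ∈ B, ∃ x ∈ T.nodes, ∃ C ∈ s, a = .concept x C) :
    Bounded s roots n (T.insertion ψ B) := by
  have hnodes : ∀ x, x ∈ (T.insertion ψ B).nodes ↔ x ∈ T.nodes := by
    intro x
    simp only [Tableau.mem_nodes, Tableau.mem_insertion]
    constructor
    · rintro ⟨a, ha | ha, hx⟩
      · exact ⟨a, ha, hx⟩
      · obtain ⟨y, hy, C, -, rfl⟩ := hB a ha
        rw [Assertion.mem_nodes_concept] at hx
        subst hx
        exact Tableau.mem_nodes.1 hy
    · rintro ⟨a, ha, hx⟩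
      exact ⟨a, .inl ha, hx⟩
  refine ⟨hT.reduced.insertion hψ B, fun x C h => ?_, ?_, ?_, ?_, ?_⟩
  · rcases Tableau.mem_insertion.1 h with h | h
    · exact hT.mem x C h
    · obtain ⟨_, -, D, hD, h⟩ := hB _ h
      cases h
      exact hD
  · simpa only [hnodes] using hT.root
  · simpa only [hnodes] using hT.parent
  · simpa only [hnodes] using hT.depth
  · simp only [hnodes]
    obtain ⟨tag, h₁, h₂⟩ := hT.tag
    exact ⟨tag, fun x k h => (h₁ x k h).insertion ψ B, h₂⟩

/-- The `∃`-rule preserves the invariant: a child with the same tag would be a witness. -/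
theorem Bounded.insertion_ex {K : ProbKB NC NR NI ι} {s : Finset (NConcept NC NR)}
    (hs : SubClosed (s : Set (NConcept NC NR))) {roots : Finset (Node NI)} {n : ℕ}
    {T : Tableau NC NR NI ι} (hT : Bounded s roots n T) {x : Node NI} {S : Role NR}
    {C : NConcept NC NR} {k : ℕ} (hx : .concept x (.ex S C) ∈ T.assertions) (hdepth : x.depth < n)
    (happ : ∀ z, ¬ K.Witness T (T.lab (.concept x (.ex S C))) x z S C)
    (hfresh : .anon x k ∉ T.nodes) {B : Finset (Assertion NC NR NI)}
    (hB : ∀ a, a ∈ B ↔ a = .role x (.anon x k) S ∨ a = .concept (.anon x k) C) :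
    Bounded s roots n (T.insertion (T.lab (.concept x (.ex S C))) B) := by
  classical
  set ψ := T.lab (.concept x (.ex S C)) with hψ
  have hψr : ψ.IsReduced := hT.reduced _ hx
  have hxT : x ∈ T.nodes := Tableau.mem_nodes.2 ⟨_, hx, by simp⟩
  have hnodes : ∀ y, y ∈ (T.insertion ψ B).nodes ↔ y ∈ T.nodes ∨ y = .anon x k := by
    intro y
    simp only [Tableau.mem_nodes, Tableau.mem_insertion, hB]
    constructor
    · rintro ⟨a, ha | rfl | rfl, hy⟩
      · exact .inl ⟨a, ha, hy⟩
      · rw [Assertion.mem_nodes_role] at hy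
        rcases hy with rfl | rfl
        · exact .inl ⟨_, hx, by simp⟩
        · exact .inr rfl
      · exact .inr (by simpa using hy)
    · rintro (⟨a, ha, hy⟩ | rfl)
      · exact ⟨a, .inl ha, hy⟩
      · exact ⟨.concept (.anon x k) C, .inr (.inr rfl), by simp⟩
  refine ⟨hT.reduced.insertion hψr B, fun y D h => ?_, ?_, ?_, ?_, ?_⟩
  · rw [Tableau.mem_insertion, hB] at h
    rcases h with h | h | h
    · exact hT.mem y D h
    · cases S <;> cases h
    · cases h
      exact hs.ex S C (hT.mem _ _ hx)
  · simp only [hnodes]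
    rintro y (hy | rfl) hroot
    · exact hT.root y hy hroot
    · exact hroot.elim
  · simp only [hnodes, Node.anon.injEq]
    rintro y l (hy | ⟨rfl, rfl⟩)
    · exact .inl (hT.parent y l hy)
    · exact .inl hxT
  · simp only [hnodes]
    rintro y (hy | rfl)
    · exact hT.depth y hy
    · exact hdepth
  · obtain ⟨tag, h₁, h₂⟩ := hT.tag
    let t : Option (s × (Finset ι → Bool)) := some (⟨.ex S C, hT.mem _ _ hx⟩, ψ.eval)
    have hne : ∀ l, .anon x l ∈ T.nodes → tag (.anon x l) ≠ t := by
      intro l hl ht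
      obtain ⟨⟨h₃, h₄⟩, h₅⟩ := h₁ x l hl _ _ ht S C rfl
      refine happ (.anon x l) ⟨⟨S, ∅, .refl, h₃, ?_⟩, ?_⟩
      · rw [(hT.reduced.psi (by simpa using h₃) ∅).or_eq_left_iff hψr]
        intro σ hσ
        rw [eval_psi]
        simpa using (h₅ σ hσ).1.2
      · rw [hT.reduced.insertable_iff hψr]
        push Not
        exact ⟨h₄, fun σ hσ => (h₅ σ hσ).2⟩
    refine ⟨Function.update tag (.anon x k) t, fun y l hy => ?_, fun y l l' hy hy' ht => ?_⟩
    · by_cases h : Node.anon y l = .anon x k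
      · rw [h, Function.update_self]
        cases h
        intro D f ht S' C' hD
        simp only [t, Option.some.injEq, Prod.mk.injEq] at ht
        obtain ⟨rfl, rfl⟩ := ht
        cases hD
        simp only [Tableau.mem_insertion, Tableau.holds_insertion, hB, true_or, or_true, true_and]
        exact fun σ hσ => ⟨.inr hσ, .inr hσ⟩
      · rw [Function.update_of_ne h]
        exact (h₁ y l (((hnodes _).1 hy).resolve_right h)).insertion _ _
    · rw [hnodes] at hy hy'
      by_cases h : Node.anon y l = .anon x k <;> by_cases h' : Node.anon y l' = .anon x k
      · cases h; cases h'; rfl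
      · rw [h, Function.update_self, Function.update_of_ne h'] at ht
        cases h
        exact (hne _ (hy'.resolve_right h') ht.symm).elim
      · rw [h', Function.update_self, Function.update_of_ne h] at ht
        cases h'
        exact (hne _ (hy.resolve_right h) ht).elim
      · rw [Function.update_of_ne h, Function.update_of_ne h'] at ht
        exact h₂ y l l' (hy.resolve_right h) (hy'.resolve_right h') ht

/-- Every rule application preserves the invariant and makes progress. -/
theorem Bounded.expands [Fintype ι] {K : ProbKB NC NR NI ι} {s : Finset (NConcept NC NR)}
    (hs : RuleClosed K (s : Set (NConcept NC NR))) {roots : Finset (Node NI)} {n : ℕ}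
    (hn : Nat.card (s → Option (Finset ι → Bool)) ≤ n) {T : Tableau NC NR NI ι}
    (hT : Bounded s roots n T) {Ts : List (Tableau NC NR NI ι)} (h : K.Expands T Ts) :
    ∀ T' ∈ Ts, Bounded s roots n T' ∧ (records s T).card < (records s T').card := by
  cases h with
  | rule B₀ E Bs hrule hB₀ happ =>
    simp only [List.mem_map]
    rintro _ ⟨B, hB, rfl⟩
    have hψ := hT.reduced.psi hB₀ E
    have hBs : ∀ a ∈ B, ∃ x ∈ T.nodes, ∃ C ∈ s, a = .concept x C := by
      intro a ha
      obtain ⟨x, hx, C, rfl⟩ := hrule.exists_eq_concept hB₀ hB ha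
      exact ⟨x, hx, C, hrule.mem_of_ruleClosed hs hT.mem hB₀ hB ha, rfl⟩
    refine ⟨hT.insertion hψ hBs, ?_⟩
    obtain ⟨a, ha⟩ := happ B hB
    obtain ⟨x, hx, C, hC, rfl⟩ := hBs a (Tableau.mem_ins.1 ha).1
    exact card_records_insertion_lt hT.reduced hψ hC ha
  | ex x S C k hx hblock happ hfresh =>
    simp only [List.mem_singleton]
    rintro _ rfl
    have hd := (Tableau.depth_lt_of_not_blocked hT.reduced hT.mem hblock).trans_le hn
    refine ⟨hT.insertion_ex hs.toSubClosed hx hd happ hfresh (by simp), ?_⟩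
    refine card_records_insertion_lt hT.reduced (hT.reduced _ hx) (x := .anon x k) (C := C)
      (hs.ex S C (hT.mem _ _ hx)) (Tableau.mem_ins.2 ⟨by simp, .inl fun h => hfresh ?_⟩)
    exact Tableau.mem_nodes.2 ⟨_, h, by simp⟩

/-- A forest measure that rule applications decrease although they may duplicate tableaux. -/
noncomputable def forestMeasure [Fintype ι] (s : Finset (NConcept NC NR))
    (roots : Finset (Node NI)) (n : ℕ) (F : List (Tableau NC NR NI ι)) : ℕ :=
  (F.map fun T => 3 ^ (recordBound ι s roots n - (records s T).card)).sum

theorem Step.bounded [Fintype ι] {K : ProbKB NC NR NI ι} {s : Finset (NConcept NC NR)}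
    (hs : RuleClosed K (s : Set (NConcept NC NR))) {roots : Finset (Node NI)} {n : ℕ}
    (hn : Nat.card (s → Option (Finset ι → Bool)) ≤ n) {F F' : List (Tableau NC NR NI ι)}
    (hF : ∀ T ∈ F, Bounded s roots n T) (h : K.Step F F') :
    (∀ T ∈ F', Bounded s roots n T) ∧ forestMeasure s roots n F' < forestMeasure s roots n F := by
  refine ⟨forall_mem_of_reach (fun T Ts hT h T' hT' => (hT.expands hs hn h T' hT').1)
    (.single h) hF, ?_⟩
  obtain ⟨F₁, F₂, Ts, T, h⟩ := h
  have hT := hF T (by simp)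
  simp only [forestMeasure, List.map_append, List.sum_append, List.map_cons, List.sum_cons]
  -- At most two tableaux replace `T`, each with a smaller exponent, and `2 * 3 ^ m < 3 ^ (m + 1)`.
  suffices (Ts.map fun T => 3 ^ (recordBound ι s roots n - (records s T).card)).sum <
      3 ^ (recordBound ι s roots n - (records s T).card) by omega
  by_cases hnil : Ts = []
  · simp [hnil]
  obtain ⟨T₀, hT₀⟩ := List.exists_mem_of_ne_nil Ts hnil
  have hlt : (records s T).card < recordBound ι s roots n :=
    (hT.expands hs hn h T₀ hT₀).2.trans_le (hT.expands hs hn h T₀ hT₀).1.card_records_le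
  obtain ⟨m, hm⟩ : ∃ m, recordBound ι s roots n - (records s T).card = m + 1 :=
    Nat.exists_eq_succ_of_ne_zero (by omega)
  have hle : (Ts.map fun T => 3 ^ (recordBound ι s roots n - (records s T).card)).sum ≤
      Ts.length * 3 ^ m := by
    have := List.sum_le_card_nsmul
      (Ts.map fun T => 3 ^ (recordBound ι s roots n - (records s T).card)) (3 ^ m) ?_
    · simpa using this
    · intro a ha
      obtain ⟨T', hT', rfl⟩ := List.mem_map.1 ha
      have := (hT.expands hs hn h T' hT').2
      exact Nat.pow_le_pow_right (by norm_num) (by omega)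
  have := Nat.mul_le_mul_right (3 ^ m) h.length_le
  rw [hm, pow_succ]
  have : 0 < 3 ^ m := by positivity
  omega

theorem labelsReduced_initial [Fintype ι] (K : ProbKB NC NR NI ι) (Q : KBAxiom NC NR NI) :
    (K.initial Q).LabelsReduced := by
  have key : ∀ (L : List ι) (T : Tableau NC NR NI ι), T.LabelsReduced →
      (L.foldl (fun T i => T.insertion (BDD.var i) (K.ax i).assertion) T).LabelsReduced := by
    intro L
    induction L with
    | nil => exact fun _ h => h
    | cons i L ih => exact fun T h => ih _ (h.insertion (BDD.isReduced_var i) _)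
  exact key _ _ fun _ _ => trivial

theorem exists_bounded_initial [Fintype ι] (K : ProbKB NC NR NI ι) (Q : KBAxiom NC NR NI) :
    ∃ (s : Finset (NConcept NC NR)) (n : ℕ), RuleClosed K (s : Set (NConcept NC NR)) ∧
      Nat.card (s → Option (Finset ι → Bool)) ≤ n ∧
      Bounded s (K.initial Q).nodes n (K.initial Q) := by
  let concepts : Assertion NC NR NI → Set (NConcept NC NR) := fun
    | .concept _ C => {C}
    | _ => ∅
  have hfin : (⋃ a ∈ (K.initial Q).assertions, concepts a).Finite := by
    refine Set.Finite.biUnion (K.initial Q).assertions.finite_toSet fun a _ => ?_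
    cases a <;> simp [concepts]
  obtain ⟨s, hsfin, hs, hsub⟩ := exists_finite_ruleClosed K hfin
  lift s to Finset (NConcept NC NR) using hsfin
  have hroot : ∀ x k, .anon x k ∉ (K.initial Q).nodes := fun x k h => isRoot_of_mem_initial h
  refine ⟨s, _, hs, le_rfl, K.labelsReduced_initial Q, fun x C h => ?_, fun x hx _ => hx,
    fun x k h => (hroot x k h).elim, fun x hx => ?_,
    fun _ => none, fun x k h => (hroot x k h).elim, fun x k _ h => (hroot x k h).elim⟩
  · exact hsub (Set.mem_biUnion h (by simp [concepts]))
  · rw [Node.depth_eq_zero_iff.2 (isRoot_of_mem_initial hx)]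
    exact Nat.zero_le _

theorem tornadoTerminates [Fintype ι] (K : ProbKB NC NR NI ι) (Q : KBAxiom NC NR NI) :
    K.TornadoTerminates Q := by
  rintro ⟨F, h0, hstep⟩
  obtain ⟨s, n, hs, hn, hinit⟩ := K.exists_bounded_initial Q
  have key : ∀ m, (∀ T ∈ F m, Bounded s (K.initial Q).nodes n T) ∧
      forestMeasure s (K.initial Q).nodes n (F m) + m ≤
        forestMeasure s (K.initial Q).nodes n (F 0) := by
    intro m
    induction m with
    | zero => exact ⟨by simpa [h0] using hinit, le_rfl⟩
    | succ m ih =>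
      have := (hstep m).bounded hs hn ih.1
      exact ⟨this.1, by have := this.2; have := ih.2; omega⟩
  have := (key (forestMeasure s (K.initial Q).nodes n (F 0) + 1)).2
  omega

theorem exists_fullyExpanded [Fintype ι] (K : ProbKB NC NR NI ι) (Q : KBAxiom NC NR NI) :
    ∃ F, Relation.ReflTransGen K.Step [K.initial Q] F ∧ K.FullyExpanded F := by
  by_contra! hF
  -- Otherwise every forest of a run can be expanded, which yields an infinite run.
  have hnext : ∀ F : {F // Relation.ReflTransGen K.Step [K.initial Q] F},
      ∃ F' : {F // Relation.ReflTransGen K.Step [K.initial Q] F}, K.Step F F' := by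
    rintro ⟨F, h⟩
    have := hF F h
    rw [FullyExpanded] at this
    push Not at this
    obtain ⟨T, hT, Ts, hTs⟩ := this
    obtain ⟨F₁, F₂, rfl⟩ := List.append_of_mem hT
    exact ⟨⟨_, h.tail (.mk F₁ F₂ Ts T hTs)⟩, .mk F₁ F₂ Ts T hTs⟩
  choose next hnext using hnext
  refine K.tornadoTerminates Q ⟨fun m => (next^[m] ⟨_, .refl⟩).1, rfl, fun m => ?_⟩
  simp only [Function.iterate_succ_apply']
  exact hnext _

/-! ### Correctness -/

theorem isReduced_finalBDD [Fintype ι] {K : ProbKB NC NR NI ι} {Q : KBAxiom NC NR NI}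
    {F : List (Tableau NC NR NI ι)} (h : Relation.ReflTransGen K.Step [K.initial Q] F) :
    (finalBDD F).IsReduced := by
  obtain ⟨s, n, hs, hn, hinit⟩ := K.exists_bounded_initial Q
  have := forall_mem_of_reach (fun T Ts hT h T' hT' => (Bounded.expands hs hn hT h T' hT').1) h
    (by simpa using hinit)
  refine .conj fun A hA => ?_
  obtain ⟨T, hT, rfl⟩ := List.mem_map.1 hA
  exact (this T hT).reduced.clashBDD

/-- The final BDD of a fully expanded forest is true under exactly the selections of axioms that
entail the query, so its probability is that of the query. -/
theorem prob_finalBDD [Fintype ι] {K : ProbKB NC NR NI ι} {Q : KBAxiom NC NR NI}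
    {F : List (Tableau NC NR NI ι)} (h : Relation.ReflTransGen K.Step [K.initial Q] F)
    (hF : K.FullyExpanded F) : (finalBDD F).prob K.p = queryProb.{v} K Q := by
  classical
  rw [(isReduced_finalBDD h).prob_eq_expect, queryProb_eq_expect]
  refine expect_congr fun σ _ => ?_
  have : (finalBDD F).eval σ = true ↔ Entails.{v} (K.selected σ) Q :=
    ⟨entails_of_eval_finalBDD h, eval_finalBDD_of_entails h hF⟩
  simp only [this]

end ProbKB

end Tornado

theorem mainTheorem1 {NC NR NI ι : Type*} [Fintype ι] [LinearOrder ι]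
    (K : Tornado.ProbKB NC NR NI ι) (Q : Tornado.KBAxiom NC NR NI) :
    K.TornadoTerminates Q ∧
      ∀ r : ℝ, K.TornadoReturns Q r ↔ r = Tornado.ProbKB.queryProb.{v} K Q := by
  refine ⟨K.tornadoTerminates Q, fun r => ⟨?_, ?_⟩⟩
  · rintro ⟨F, h, hF, rfl⟩
    exact Tornado.ProbKB.prob_finalBDD h hF
  · rintro rfl
    obtain ⟨F, h, hF⟩ := K.exists_fullyExpanded Q
    exact ⟨F, h, hF, (Tornado.ProbKB.prob_finalBDD h hF).symm⟩
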